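/- **Setting.** Let $q_{AB}$ be a smooth Riemannian metric on $\mathbb S^2$ with area measure $dS$, and let $\kappa>0$ (the cross-section metric and the surface gravity of the horizon). The horizon is $\mathbb R\times\mathbb S^2\ni(U,x)$ with affine parameter $U$ along its null generators, related to Killing time $u$ by $U=e^{\kappa u}$. A *test tensor* is a smooth, compactly supported, complex tensor field $s^{AB}(U,x)$, symmetric, tangent to $\mathbb S^2$, with $q_{AB}s^{AB}=0$. The *one-particle space* is the completion of the test tensors in $$\langle s,t\rangle=\lim_{\epsilon\to0^+}-\frac1\pi\int_{\mathbb S^2}dS\int_{\mathbb R^2}dU_1\,dU_2\;\frac{q_{AC}\,q_{BD}\,\overline{s^{AB}(U_1,x)}\,t^{CD}(U_2,x)}{(U_1-U_2-i\epsilon)^2},$$ realised by the wavefunctions $\pi^{-1/2}k\int s^{AB}(U,x)e^{ikU}dU$ (in an orthonormal frame) in $L^2$ of $\{k>0\}\times\mathbb S^2$ with measure $\frac{dk}{k}dS$. The graviton Fock space $\mathscr F$ is the symmetric Fock space over it, with vacuum $\omega$; the $n$-particle component of $\Psi\in\mathscr F$ is a symmetric, tensor-valued function $\Psi_n$ of $(k_1,x_1),\dots,(k_n,x_n)$.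 The symmetry group $G=H_{\rm isom}\ltimes\mathcal S$ consists of the pairs $(f,R)$ of a function $f\in\mathcal S=C^\infty(\mathbb S^2,\mathbb R)$ and a rotation $R\in SO(3)$ of $\mathbb S^2$ which is an isometry of $q$. It acts on $\mathscr F$ by isometries, by second quantization of the pushforward of test tensors under $R$ followed by the *boost supertranslation* $u\mapsto u+f(x)$, i.e. $U\mapsto e^{\kappa f(x)}U$. A normalizable state is a unit vector up to phase. A state $\Psi$ is invariant under a symmetry if the symmetry maps $\Psi$ to a multiple of itself. **Theorem.** 1. Let $f$ be a smooth real function on $\mathbb S^2$ which does not vanish identically on any non-empty open subset of $\mathbb S^2$. Let $\Psi$ be a normalizable state in $\mathscr F$ that is invariant under the boost supertranslation $u\mapsto u+f$. Suppose that the zero set of $f$ has area zero, or that all wavefunctions $\Psi_n$ are continuous. Then $\Psi$ is the vacuum state $\omega$. 2. The vacuum vector is fixed by every element of $G$. 3. Consequently, no restriction to a finite-dimensional group of symmetries is consistent. Precisely: let $G_{\rm sub}\subset G$ be a subgroup (or any subset) such that the pure boost supertranslations contained in $G_{\rm sub}$ span a finite-dimensional subspace $V\subset\mathcal S$ (for example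 $G_{\rm sub}=\mathbb R$, the constants, or the full isometry group $\mathbb R\times H_{\rm isom}$). Then for every linear complement $W$ of $V$ in $\mathcal S$ (the remaining boost supertranslations $\mathcal S/V$), the only normalizable state in $\mathscr F$ that is invariant under all $f\in W$ is the vacuum. Hence the necessary criterion for the dressed algebra of $G_{\rm sub}$ to be a non-trivial subalgebra of the dressed algebra of $G$, namely the existence of a non-trivial state in $\mathscr F$ invariant under the remaining symmetries, fails. -/

import Mathlib

open MeasureTheory Filter Topology
open scoped Manifold ContDiff ENNReal Pointwise

noncomputable section
namespace Horizon

/-- Euclidean three-space, in which the horizon cross-section is realised as the unit sphere. -/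
abbrev E3 := EuclideanSpace ℝ (Fin 3)

/-- The two-sphere. -/
abbrev S2 := Metric.sphere (0 : E3) 1

instance : Fact (Module.finrank ℝ E3 = 2 + 1) := ⟨by simp⟩

/-- A smooth Riemannian metric on the two-sphere (the metric of the horizon cross-section). It is
given as a field of symmetric positive definite matrices on the ambient `ℝ³`, block diagonal in
`T_x S² ⊕ ℝ x` and extended by `1` on the unit normal `x`; every smooth Riemannian metric on `S²`
has exactly one such extension. -/
structure HorizonMetric where
  metric : S2 → Matrix (Fin 3) (Fin 3) ℝ
  smooth : ∀ a b, ContMDiff (𝓡 2) 𝓘(ℝ, ℝ) ∞ fun x => metric x a b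
  posDef : ∀ x, (metric x).PosDef
  normal : ∀ x : S2, (metric x).mulVec (x : E3) = (x : E3)

namespace HorizonMetric

open scoped MatrixOrder Matrix.Norms.L2Operator in
/-- The symmetric frame `e = √q`, which turns tensor indices into orthonormal frame indices. -/
def frame (q : HorizonMetric) (x : S2) : Matrix (Fin 3) (Fin 3) ℝ := CFC.sqrt (q.metric x)

open scoped MatrixOrder Matrix.Norms.L2Operator in
theorem frame_mul_frame (q : HorizonMetric) (x : S2) : q.frame x * q.frame x = q.metric x :=
  CFC.sqrt_mul_sqrt_self _ (q.posDef x).posSemidef.nonneg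

open scoped MatrixOrder Matrix.Norms.L2Operator in
theorem frame_unique (q : HorizonMetric) (x : S2) {e : Matrix (Fin 3) (Fin 3) ℝ}
    (he : e.PosSemidef) (h : e * e = q.metric x) : q.frame x = e :=
  CFC.sqrt_unique h he.nonneg

open scoped MatrixOrder Matrix.Norms.L2Operator in
theorem frame_posSemidef (q : HorizonMetric) (x : S2) : (q.frame x).PosSemidef :=
  Matrix.nonneg_iff_posSemidef.1 (CFC.sqrt_nonneg _)

theorem continuous_metric (q : HorizonMetric) : Continuous q.metric :=
  continuous_matrix fun a b => (q.smooth a b).continuous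

open scoped MatrixOrder Matrix.Norms.L2Operator in
theorem continuous_frame (q : HorizonMetric) : Continuous q.frame :=
  (CFC.continuousOn_sqrt (A := Matrix (Fin 3) (Fin 3) ℝ)).comp_continuous q.continuous_metric
    fun x => (q.posDef x).posSemidef.nonneg

/-- The area measure: its density with respect to the round area measure is `√det q`. -/
def area (q : HorizonMetric) : Measure S2 :=
  ((volume : Measure E3).toSphere).withDensity fun x => ENNReal.ofReal √(q.metric x).det

theorem continuous_areaDensity (q : HorizonMetric) :
    Continuous fun x => √(q.metric x).det := q.continuous_metric.matrix_det.sqrt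

instance (q : HorizonMetric) : IsFiniteMeasure q.area := by
  obtain ⟨C, hC⟩ := (isCompact_univ (X := S2)).bddAbove_image q.continuous_areaDensity.continuousOn
  refine isFiniteMeasure_withDensity_ofReal (f := fun x => √(q.metric x).det) ?_
  refine (hasFiniteIntegral_const C).mono (.of_forall fun x => ?_)
  have h := hC ⟨x, trivial, rfl⟩
  simp only at h
  rw [Real.norm_of_nonneg (by positivity)]
  exact h.trans (le_abs_self _)

end HorizonMetric

/-- Boost supertranslations `u ↦ u + f(x)`, given by the smooth function `f` on the sphere. -/
abbrev Supertranslation := C^∞⟮𝓡 2, S2; ℝ⟯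


/-- Smooth compactly supported functions of `(U, x)` on the horizon `ℝ × S²`. -/
def IsTestFunction (F : ℝ × S2 → ℂ) : Prop :=
  ContMDiff (𝓘(ℝ, ℝ).prod (𝓡 2)) 𝓘(ℝ, ℂ) ∞ F ∧ HasCompactSupport F

namespace IsTestFunction

variable {F : ℝ × S2 → ℂ}

theorem contMDiff_slice (hF : IsTestFunction F) (x : S2) : ContDiff ℝ ∞ fun U => F (U, x) := by
  rw [← contMDiff_iff_contDiff]
  exact hF.1.comp (contMDiff_id.prodMk contMDiff_const)

theorem deriv_eq (hF : IsTestFunction F) : IsTestFunction fun p => deriv (fun U => F (U, p.2)) p.1 := by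
  constructor
  · intro p₀
    have h := ContMDiffAt.mfderiv_apply (I := 𝓘(ℝ, ℝ)) (I' := 𝓘(ℝ, ℂ)) (m := ∞) (n := ∞)
      (J := 𝓘(ℝ, ℝ).prod (𝓡 2)) (J' := 𝓘(ℝ, ℝ).prod (𝓡 2))
      (x₀ := p₀) (fun (p : ℝ × S2) (U : ℝ) => F (U, p.2)) Prod.fst id (fun _ => (1 : ℝ))
      ?_ contMDiffAt_fst contMDiffAt_id contMDiffAt_const le_rfl
    · simp only [inTangentCoordinates_model_space, mfderiv_eq_fderiv] at h
      exact h
    · exact hF.1.contMDiffAt.comp _ (contMDiffAt_snd.prodMk (contMDiffAt_snd.comp _ contMDiffAt_fst))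
  · refine hF.2.mono' fun p hp => ?_
    by_contra hn
    apply hp
    have : ∀ᶠ y in 𝓝 p, F y = 0 := notMem_tsupport_iff_eventuallyEq.1 hn
    have h2 : (fun U => F (U, p.2)) =ᶠ[𝓝 p.1] fun _ => 0 :=
      (Continuous.tendsto (f := fun U : ℝ => (U, p.2)) (by fun_prop) p.1).eventually this
    show deriv (fun U => F (U, p.2)) p.1 = 0
    rw [h2.deriv_eq]; simp

theorem continuous (hF : IsTestFunction F) : Continuous F := hF.1.continuous

theorem exists_bound (hF : IsTestFunction F) :
    ∃ R C : ℝ, 0 ≤ R ∧ 0 ≤ C ∧ ∀ U x, ‖F (U, x)‖ ≤ Set.indicator (Set.Icc (-R) R) (fun _ => C) U := by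
  obtain ⟨C, hC⟩ := hF.2.exists_bound_of_continuous hF.continuous
  obtain ⟨R, hR⟩ := (hF.2.isCompact.image continuous_fst).isBounded.subset_closedBall 0
  refine ⟨max R 0, max C 0, le_max_right _ _, le_max_right _ _, fun U x => ?_⟩
  by_cases hU : U ∈ Set.Icc (-(max R 0)) (max R 0)
  · rw [Set.indicator_of_mem hU]; exact (hC _).trans (le_max_left _ _)
  · rw [Set.indicator_of_notMem hU]
    have : F (U, x) = 0 := by
      by_contra hne
      have := hR ⟨(U, x), subset_tsupport _ hne, rfl⟩
      apply hU
      rw [mem_closedBall_zero_iff, Real.norm_eq_abs, abs_le] at this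
      exact ⟨by linarith [le_max_left R 0], this.2.trans (le_max_left _ _)⟩
    simp [this]

theorem hasCompactSupport_slice (hF : IsTestFunction F) (x : S2) :
    HasCompactSupport fun U => F (U, x) := by
  obtain ⟨R, C, -, -, h⟩ := hF.exists_bound
  refine HasCompactSupport.intro (isCompact_Icc (a := -R) (b := R)) fun U hU => ?_
  have := h U x
  rwa [Set.indicator_of_notMem hU, norm_le_zero_iff] at this

theorem integrable_slice (hF : IsTestFunction F) (x : S2) : Integrable fun U => F (U, x) :=
  (hF.continuous.comp (by fun_prop)).integrable_of_hasCompactSupport (hF.hasCompactSupport_slice x)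

end IsTestFunction

/-- The Fourier transform `∫ F(U, x) e^{ikU} dU` along the null generators. -/
def fourier (F : ℝ × S2 → ℂ) (k : ℝ) (x : S2) : ℂ :=
  ∫ U : ℝ, F (U, x) * Complex.exp (Complex.I * (k * U))

theorem norm_phase (k U : ℝ) : ‖Complex.exp (Complex.I * (k * U))‖ = 1 := by
  rw [mul_comm]; exact_mod_cast Complex.norm_exp_ofReal_mul_I (k * U)

namespace IsTestFunction

variable {F : ℝ × S2 → ℂ}

theorem fourier_bound (hF : IsTestFunction F) : ∃ C : ℝ, 0 ≤ C ∧ ∀ k x, ‖fourier F k x‖ ≤ C := by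
  obtain ⟨R, C, hR, hC, h⟩ := hF.exists_bound
  refine ⟨∫ U, Set.indicator (Set.Icc (-R) R) (fun _ => C) U,
    integral_nonneg fun U => Set.indicator_nonneg (fun _ _ => hC) _, fun k x => ?_⟩
  refine norm_integral_le_of_norm_le ?_ (.of_forall fun U => ?_)
  · exact (integrable_indicator_iff measurableSet_Icc).2 (by simp [integrableOn_const_iff])
  · rw [norm_mul, norm_phase, mul_one]; exact h U x

theorem fourier_deriv (hF : IsTestFunction F) (k : ℝ) (x : S2) :
    fourier (fun p => deriv (fun U => F (U, p.2)) p.1) k x = -(Complex.I * k) * fourier F k x := by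
  unfold fourier
  have hd : ∀ U : ℝ, HasDerivAt (fun U : ℝ => Complex.exp (Complex.I * (k * U)))
      (Complex.exp (Complex.I * (k * U)) * (Complex.I * k)) U := fun U => by
    have : HasDerivAt (fun U : ℝ => Complex.I * ((k : ℂ) * U)) (Complex.I * k) U := by
      simpa using ((Complex.ofRealCLM.hasDerivAt (x := U)).const_mul (k : ℂ)).const_mul Complex.I
    exact this.cexp
  have hphase : Continuous fun U : ℝ => Complex.exp (Complex.I * (k * U)) := by fun_prop
  have hi : ∀ {G : ℝ × S2 → ℂ} {e : ℝ → ℂ}, IsTestFunction G → Continuous e →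
      Integrable (fun U => G (U, x) * e U) := fun hG he =>
    ((hG.continuous.comp (by fun_prop)).mul he).integrable_of_hasCompactSupport
      (hG.hasCompactSupport_slice x).mul_right
  have key := integral_mul_deriv_eq_deriv_mul_of_integrable
    (u := fun U => F (U, x)) (u' := fun U => deriv (fun U => F (U, x)) U)
    (v := fun U : ℝ => Complex.exp (Complex.I * (k * U)))
    (v' := fun U : ℝ => Complex.exp (Complex.I * (k * U)) * (Complex.I * k))
    (fun U _ => ((hF.contMDiff_slice x).differentiable (by simp) U).hasDerivAt) (fun U _ => hd U)
    (hi hF (by fun_prop)) (hi hF.deriv_eq hphase) (hi hF hphase)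
  rw [← neg_eq_iff_eq_neg] at key
  rw [← key, ← integral_const_mul, ← integral_neg]
  congr 1; ext U; ring

theorem fourier_decay (hF : IsTestFunction F) :
    ∃ C : ℝ, 0 ≤ C ∧ ∀ k x, ‖fourier F k x‖ * k ^ 2 ≤ C := by
  obtain ⟨C, hC, h⟩ := hF.deriv_eq.deriv_eq.fourier_bound
  refine ⟨C, hC, fun k x => ?_⟩
  have := h k x
  rw [hF.deriv_eq.fourier_deriv, hF.fourier_deriv] at this
  rw [norm_mul, norm_mul, norm_neg, norm_mul, Complex.norm_I, one_mul, Complex.norm_real,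
    Real.norm_eq_abs, ← mul_assoc, abs_mul_abs_self] at this
  linarith [this]

theorem continuous_fourier (hF : IsTestFunction F) :
    Continuous fun p : ℝ × S2 => fourier F p.1 p.2 := by
  obtain ⟨R, C, hR, hC, h⟩ := hF.exists_bound
  have : (fun p : ℝ × S2 => fourier F p.1 p.2) = fun p : ℝ × S2 => ∫ U in Set.Icc (-R) R,
      F (U, p.2) * Complex.exp (Complex.I * (p.1 * U)) := by
    ext p
    symm
    refine setIntegral_eq_integral_of_forall_compl_eq_zero fun U hU => ?_
    have := h U p.2
    rw [Set.indicator_of_notMem hU, norm_le_zero_iff] at this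
    simp [this]
  rw [this]
  refine continuous_parametric_integral_of_continuous ?_ isCompact_Icc
  have := hF.continuous
  simp only [Function.uncurry_def]
  fun_prop

theorem memLp_mode (hF : IsTestFunction F) (μ : Measure S2) [IsFiniteMeasure μ] :
    MemLp (fun p : ℝ × S2 => ((Real.exp p.1 / √Real.pi : ℝ) : ℂ) * fourier F (Real.exp p.1) p.2) 2
      ((volume : Measure ℝ).prod μ) := by
  obtain ⟨A, hA, hA'⟩ := hF.fourier_bound
  obtain ⟨B, hB, hB'⟩ := hF.fourier_decay
  have hcont : Continuous fun p : ℝ × S2 =>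
      ((Real.exp p.1 / √Real.pi : ℝ) : ℂ) * fourier F (Real.exp p.1) p.2 := by
    have := hF.continuous_fourier.comp (g := fun p : ℝ × S2 => fourier F p.1 p.2)
      (f := fun p : ℝ × S2 => (Real.exp p.1, p.2)) (by fun_prop)
    simp only [Function.comp_def] at this
    fun_prop
  have hdom : Integrable (fun p : ℝ × S2 => ((A + B) ^ 2 * (1 + p.1 ^ 2)⁻¹) * (1 : ℝ))
      ((volume : Measure ℝ).prod μ) :=
    Integrable.mul_prod (f := fun t : ℝ => (A + B) ^ 2 * (1 + t ^ 2)⁻¹)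
      (g := fun _ : S2 => (1 : ℝ)) (integrable_inv_one_add_sq.const_mul _) (integrable_const _)
  rw [memLp_two_iff_integrable_sq_norm hcont.aestronglyMeasurable]
  refine hdom.mono' (hcont.norm.pow 2).aestronglyMeasurable (.of_forall fun p => ?_)
  have h1 := hA' (Real.exp p.1) p.2
  have h2 := hB' (Real.exp p.1) p.2
  set L := p.1
  set z := ‖fourier F (Real.exp L) p.2‖
  have hz : 0 ≤ z := norm_nonneg _
  have hexp : Real.exp (-|L|) ^ 2 ≤ (1 + L ^ 2)⁻¹ := by
    rw [← Real.exp_nat_mul, ← inv_inv (Real.exp _), ← Real.exp_neg]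
    refine inv_anti₀ (by positivity) ?_
    have := Real.quadratic_le_exp_of_nonneg (x := -((2 : ℕ) * -|L|)) (by simp)
    refine le_trans ?_ this
    have h4 := abs_nonneg L
    have h5 := sq_abs L
    push_cast
    nlinarith
  have hz2 : Real.exp L * z ≤ (A + B) * Real.exp (-|L|) := by
    have hp := Real.exp_pos L
    rcases le_total L 0 with h0 | h0
    · rw [abs_of_nonpos h0, neg_neg]
      nlinarith
    · rw [abs_of_nonneg h0, Real.exp_neg, ← div_eq_mul_inv, le_div_iff₀ hp]
      nlinarith
  have hpi : (1 : ℝ) ≤ √Real.pi := Real.one_le_sqrt.2 (by linarith [Real.pi_gt_three])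
  have hm : ‖((Real.exp L / √Real.pi : ℝ) : ℂ) * fourier F (Real.exp L) p.2‖ ≤ Real.exp L * z := by
    rw [norm_mul, Complex.norm_real, Real.norm_of_nonneg (by positivity)]
    exact mul_le_mul_of_nonneg_right (div_le_self (by positivity) hpi) hz
  rw [Real.norm_of_nonneg (by positivity), mul_one]
  calc _ ≤ ((A + B) * Real.exp (-|L|)) ^ 2 := by
        exact pow_le_pow_left₀ (norm_nonneg _) (hm.trans hz2) 2
    _ = (A + B) ^ 2 * Real.exp (-|L|) ^ 2 := by ring
    _ ≤ _ := by gcongr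

end IsTestFunction

/-- Test tensors `s^{AB}(U, x)` for the shear: smooth, compactly supported, symmetric, tangent to
the sphere and trace-free with respect to the metric. -/
structure TestTensor (q : HorizonMetric) where
  toFun : ℝ → S2 → Matrix (Fin 3) (Fin 3) ℂ
  isTest : ∀ a b, IsTestFunction fun p => toFun p.1 p.2 a b
  symm : ∀ U x, (toFun U x).transpose = toFun U x
  tangent : ∀ U (x : S2), (toFun U x).mulVec (fun a => (((x : E3) a : ℝ) : ℂ)) = 0
  traceFree : ∀ U x, ((q.metric x).map Complex.ofReal * toFun U x).trace = 0

/-- The matrix of a linear isometry of `ℝ³`. -/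
def rotMatrix (R : E3 ≃ₗᵢ[ℝ] E3) : Matrix (Fin 3) (Fin 3) ℝ :=
  Matrix.of fun a b => R (EuclideanSpace.single b 1) a

theorem rotMatrix_mulVec (R : E3 ≃ₗᵢ[ℝ] E3) (v : E3) : (rotMatrix R).mulVec v = R v := by
  have h : v = ∑ b, v b • EuclideanSpace.single b (1 : ℝ) := by
    ext a; simp [Pi.single_apply]
  conv_rhs => rw [h]
  ext a
  simp [Matrix.mulVec, dotProduct, rotMatrix, mul_comm]

theorem rotMatrix_transpose_mul (R : E3 ≃ₗᵢ[ℝ] E3) :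
    (rotMatrix R).transpose * rotMatrix R = 1 := by
  ext a b
  have h := R.inner_map_map (EuclideanSpace.single a (1 : ℝ)) (EuclideanSpace.single b (1 : ℝ))
  rw [EuclideanSpace.inner_eq_star_dotProduct, EuclideanSpace.inner_eq_star_dotProduct] at h
  simp only [Matrix.mul_apply, Matrix.transpose_apply, rotMatrix, Matrix.of_apply]
  simp [dotProduct] at h
  simp [Matrix.one_apply, Pi.single_apply, mul_comm] at h ⊢
  rw [h]
  simp only [eq_comm]

theorem rotMatrix_mul_transpose (R : E3 ≃ₗᵢ[ℝ] E3) :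
    rotMatrix R * (rotMatrix R).transpose = 1 :=
  mul_eq_one_comm.1 (rotMatrix_transpose_mul R)

/-- The action of a linear isometry of `ℝ³` on the sphere. -/
def rotSphere (R : E3 ≃ₗᵢ[ℝ] E3) (x : S2) : S2 := ⟨R x, by simp⟩

theorem contMDiff_rotSphere (R : E3 ≃ₗᵢ[ℝ] E3) : ContMDiff (𝓡 2) (𝓡 2) ∞ (rotSphere R) :=
  ContMDiff.codRestrict_sphere (m := ∞) (n := 2) (f := fun x : S2 => R x)
    (R.contDiff.contMDiff.comp contMDiff_coe_sphere) _

theorem continuous_rotSphere (R : E3 ≃ₗᵢ[ℝ] E3) : Continuous (rotSphere R) :=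
  (contMDiff_rotSphere R).continuous

@[simp] theorem rotSphere_symm_rotSphere (R : E3 ≃ₗᵢ[ℝ] E3) (x : S2) :
    rotSphere R.symm (rotSphere R x) = x := by ext1; simp [rotSphere]

@[simp] theorem rotSphere_rotSphere_symm (R : E3 ≃ₗᵢ[ℝ] E3) (x : S2) :
    rotSphere R (rotSphere R.symm x) = x := by ext1; simp [rotSphere]

theorem measurePreserving_rotSphere (R : E3 ≃ₗᵢ[ℝ] E3) :
    MeasurePreserving (rotSphere R) (volume : Measure E3).toSphere (volume : Measure E3).toSphere := by
  have hm : Measurable (rotSphere R) := (continuous_rotSphere R).measurable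
  refine ⟨hm, Measure.ext fun s hs => ?_⟩
  rw [Measure.map_apply hm hs, Measure.toSphere_apply' _ hs, Measure.toSphere_apply' _ (hm hs)]
  congr 1
  have : Set.Ioo (0 : ℝ) 1 • ((↑) '' (rotSphere R ⁻¹' s) : Set E3)
      = R ⁻¹' (Set.Ioo (0 : ℝ) 1 • ((↑) '' s : Set E3)) := by
    ext v
    simp only [Set.mem_smul, Set.mem_image, Set.mem_preimage]
    constructor
    · rintro ⟨r, hr, _, ⟨x, hx, rfl⟩, rfl⟩
      exact ⟨r, hr, _, ⟨rotSphere R x, hx, rfl⟩, by simp [rotSphere]⟩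
    · rintro ⟨r, hr, _, ⟨y, hy, rfl⟩, h⟩
      refine ⟨r, hr, _, ⟨rotSphere R.symm y, by simpa using hy, rfl⟩, ?_⟩
      apply R.injective
      rw [← h]; simp [rotSphere]
  rw [this]
  exact (R.measurePreserving).measure_preimage_equiv (f := R.toMeasurableEquiv) _

/-- An element of the horizon symmetry group: a rotation of the cross-section that is an isometry
of its metric, followed by the boost supertranslation `u ↦ u + f(x)`. -/
structure Symmetry (q : HorizonMetric) where
  f : Supertranslation
  rot : E3 ≃ₗᵢ[ℝ] E3
  det_rot : (rotMatrix rot).det = 1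
  isometry : ∀ x, (rotMatrix rot).transpose * q.metric (rotSphere rot x) * rotMatrix rot = q.metric x

namespace Symmetry

variable {q : HorizonMetric} (g : Symmetry q) (κ : ℝ)

theorem metric_rot (x : S2) :
    q.metric (rotSphere g.rot x) = rotMatrix g.rot * q.metric x * (rotMatrix g.rot).transpose := by
  rw [← g.isometry x]
  simp only [← mul_assoc, rotMatrix_mul_transpose, one_mul]
  rw [mul_assoc, rotMatrix_mul_transpose, mul_one]

theorem frame_rot (x : S2) :
    q.frame (rotSphere g.rot x) = rotMatrix g.rot * q.frame x * (rotMatrix g.rot).transpose := by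
  refine q.frame_unique _ ?_ ?_
  · simpa using (q.frame_posSemidef x).mul_mul_conjTranspose_same (rotMatrix g.rot)
  · rw [g.metric_rot, ← q.frame_mul_frame]
    calc _ = rotMatrix g.rot * q.frame x * ((rotMatrix g.rot).transpose * rotMatrix g.rot)
          * q.frame x * (rotMatrix g.rot).transpose := by simp only [mul_assoc]
      _ = _ := by rw [rotMatrix_transpose_mul]; simp only [mul_assoc, one_mul]

theorem measurePreserving_area : MeasurePreserving (rotSphere g.rot) q.area q.area := by
  have h := measurePreserving_rotSphere g.rot
  refine ⟨h.measurable, Measure.ext fun s hs => ?_⟩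
  rw [Measure.map_apply h.measurable hs, HorizonMetric.area, withDensity_apply _ hs,
    withDensity_apply _ (h.measurable hs), ← h.setLIntegral_comp_preimage hs
      q.continuous_areaDensity.measurable.ennreal_ofReal]
  refine lintegral_congr fun x => ?_
  rw [g.metric_rot, Matrix.det_mul, Matrix.det_mul, Matrix.det_transpose, g.det_rot]
  simp

/-- The action on test tensors. With surface gravity `κ` and affine coordinate `U = e^{κu}`, the
map `u ↦ u + f` is `U ↦ e^{κ f} U`; test tensors are pushed forward. -/
def actTest (s : TestTensor q) : TestTensor q where
  toFun U x := (rotMatrix g.rot).map Complex.ofReal *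
    s.toFun (Real.exp (-(κ * g.f x)) * U) (rotSphere g.rot.symm x) *
      (rotMatrix g.rot).transpose.map Complex.ofReal
  isTest a b := by
    have h : ∀ c d, IsTestFunction fun p : ℝ × S2 =>
        s.toFun (Real.exp (-(κ * g.f p.2)) * p.1) (rotSphere g.rot.symm p.2) c d := fun c d => by
      have hs := s.isTest c d
      have hf : ContMDiff (𝓘(ℝ, ℝ).prod (𝓡 2)) 𝓘(ℝ, ℝ) ∞ fun p : ℝ × S2 => g.f p.2 :=
        g.f.contMDiff.comp contMDiff_snd
      have he : ContMDiff (𝓘(ℝ, ℝ).prod (𝓡 2)) 𝓘(ℝ, ℝ) ∞ fun p : ℝ × S2 =>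
          Real.exp (-(κ * g.f p.2)) * p.1 :=
        ((Real.contDiff_exp.comp (contDiff_const.mul contDiff_id).neg).contMDiff.comp hf).mul
          contMDiff_fst
      refine ⟨hs.1.comp (he.prodMk ((contMDiff_rotSphere _).comp contMDiff_snd)), ?_⟩
      let e : ℝ × S2 ≃ₜ ℝ × S2 :=
        { toFun := fun p => (Real.exp (-(κ * g.f p.2)) * p.1, rotSphere g.rot.symm p.2)
          invFun := fun p => (Real.exp (κ * g.f (rotSphere g.rot p.2)) * p.1, rotSphere g.rot p.2)
          left_inv := fun p => by
            ext1
            · simp [← mul_assoc, ← Real.exp_add]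
            · simp
          right_inv := fun p => by
            ext1
            · simp [← mul_assoc, ← Real.exp_add]
            · exact rotSphere_symm_rotSphere _ _
          continuous_toFun := he.continuous.prodMk ((continuous_rotSphere _).comp continuous_snd)
          continuous_invFun := by
            have := g.f.contMDiff.continuous
            have := continuous_rotSphere g.rot
            fun_prop }
      exact hs.2.comp_homeomorph e
    simp only [Matrix.mul_apply, Finset.sum_mul]
    have hsum : ∀ {F : Fin 3 → ℝ × S2 → ℂ}, (∀ c, IsTestFunction (F c)) →
        IsTestFunction fun p => ∑ c, F c p := fun {F} hF => by
      simp only [Fin.sum_univ_three]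
      exact ⟨((hF 0).1.add (hF 1).1).add (hF 2).1, ((hF 0).2.add (hF 1).2).add (hF 2).2⟩
    exact hsum fun c => hsum fun d =>
      ⟨((contDiff_const.mul contDiff_id).mul contDiff_const : ContDiff ℝ ∞ fun z : ℂ =>
        (rotMatrix g.rot).map Complex.ofReal a d * z *
          (rotMatrix g.rot).transpose.map Complex.ofReal c b).contMDiff.comp (h d c).1,
        ((h d c).2.mul_left).mul_right⟩
  symm U x := by
    simp only [Matrix.transpose_mul, s.symm, ← Matrix.transpose_map, Matrix.transpose_transpose,
      mul_assoc]
  tangent U x := by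
    have h : ((rotMatrix g.rot).transpose.map Complex.ofReal).mulVec
        (fun a => (((x : E3) a : ℝ) : ℂ))
        = fun a => (((rotSphere g.rot.symm x : E3) a : ℝ) : ℂ) := by
      have h1 : (rotMatrix g.rot).transpose.mulVec (x : E3) = (rotSphere g.rot.symm x : E3) := by
        have h2 := rotMatrix_mulVec g.rot (rotSphere g.rot.symm x : E3)
        have h3 : g.rot (rotSphere g.rot.symm x : E3) = x := by simp [rotSphere]
        rw [h3] at h2
        rw [← h2, Matrix.mulVec_mulVec, rotMatrix_transpose_mul, Matrix.one_mulVec]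
      ext a
      rw [← h1]
      simp [Matrix.mulVec, dotProduct]
    rw [← Matrix.mulVec_mulVec, h, ← Matrix.mulVec_mulVec, s.tangent, Matrix.mulVec_zero]
  traceFree U x := by
    have h := g.isometry (rotSphere g.rot.symm x)
    rw [rotSphere_rotSphere_symm] at h
    have h2 := s.traceFree (Real.exp (-(κ * g.f x)) * U) (rotSphere g.rot.symm x)
    rw [← h] at h2
    have hm : ∀ A B : Matrix (Fin 3) (Fin 3) ℝ, (A * B).map Complex.ofReal
        = A.map Complex.ofReal * B.map Complex.ofReal := fun A B => Matrix.map_mul (f := Complex.ofRealHom)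
    rw [hm, hm] at h2
    rw [← mul_assoc, Matrix.trace_mul_comm, ← h2]
    simp only [mul_assoc]

end Symmetry

/-- Polarisation tensors of `n` particles, in an orthonormal frame. -/
abbrev Pol (n : ℕ) := EuclideanSpace ℂ (Fin n → Fin 3 × Fin 3)

/-- Configurations of `n` particles: each has a log-frequency `L` (affine frequency `k = e^L > 0`)
and an angle. -/
abbrev Conf (n : ℕ) := Fin n → ℝ × S2

instance (q : HorizonMetric) : SigmaFinite ((volume : Measure ℝ).prod q.area) := inferInstance

/-- The product of the measures `dL × dS`, with `dL = dk / k`. -/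
def confMeasure (q : HorizonMetric) (n : ℕ) : Measure (Conf n) :=
  Measure.pi fun _ => (volume : Measure ℝ).prod q.area

namespace TestTensor

variable {q : HorizonMetric}

/-- The one-particle wavefunction `k ŝ(k, x) / √π`, `k = e^L`, of a test tensor, in frame
components. The inner product of these wavefunctions in `L²(dL × dS)` is the vacuum two-point
function, see `tendsto_twoPoint`. -/
def mode (s : TestTensor q) (p : ℝ × S2) : Matrix (Fin 3) (Fin 3) ℂ :=
  (q.frame p.2).map Complex.ofReal *
    Matrix.of (fun a b => ((Real.exp p.1 / √Real.pi : ℝ) : ℂ) *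
      fourier (fun y => s.toFun y.1 y.2 a b) (Real.exp p.1) p.2) *
    (q.frame p.2).map Complex.ofReal

theorem memLp_mode (s : TestTensor q) (i : Fin 3 × Fin 3) :
    MemLp (fun p => s.mode p i.1 i.2) 2 ((volume : Measure ℝ).prod q.area) := by
  simp only [mode, Matrix.mul_apply, Finset.sum_mul]
  refine memLp_finsetSum _ fun c _ => memLp_finsetSum _ fun d _ => ?_
  have hc : ∀ a b, Continuous fun p : ℝ × S2 => ((q.frame p.2).map Complex.ofReal a b : ℂ) :=
    fun a b => Complex.continuous_ofReal.comp ((q.continuous_frame.comp continuous_snd).matrix_elem a b)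
  have hb : ∀ a b, ∃ C : ℝ, ∀ p : ℝ × S2, ‖((q.frame p.2).map Complex.ofReal a b : ℂ)‖ ≤ C :=
    fun a b => by
    have h1 : Continuous fun x : S2 => ((q.frame x).map Complex.ofReal a b : ℂ) :=
      Complex.continuous_ofReal.comp (q.continuous_frame.matrix_elem a b)
    obtain ⟨C, hC⟩ := (isCompact_univ (X := S2)).bddAbove_image h1.norm.continuousOn
    exact ⟨C, fun p => hC ⟨p.2, trivial, rfl⟩⟩
  obtain ⟨C₁, h₁⟩ := hb i.1 d
  obtain ⟨C₂, h₂⟩ := hb c i.2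
  have hm := (s.isTest d c).memLp_mode q.area
  refine (hm.norm.const_mul (C₁ * C₂)).mono ?_ (.of_forall fun p => ?_)
  · exact ((hc _ _).aestronglyMeasurable.mul hm.1).mul (hc _ _).aestronglyMeasurable
  · rw [norm_mul, norm_mul, norm_mul, norm_norm]
    have := (norm_nonneg _).trans (h₁ p)
    have := (norm_nonneg _).trans (h₂ p)
    rw [Real.norm_of_nonneg (by positivity)]
    rw [Matrix.of_apply, mul_right_comm C₁]
    gcongr
    · exact h₁ p
    · exact h₂ p

/-- The symmetrised product of the one-particle wavefunctions of `n` test tensors. -/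
def symFun {n : ℕ} (s : Fin n → TestTensor q) (p : Conf n) : Pol n :=
  WithLp.toLp 2 fun a => (n.factorial : ℂ)⁻¹ *
    ∑ σ : Equiv.Perm (Fin n), ∏ i, (s (σ i)).mode (p i) (a i).1 (a i).2

theorem memLp_symFun {n : ℕ} (s : Fin n → TestTensor q) :
    MemLp (symFun s) 2 (confMeasure q n) := by
  refine MemLp.of_eval_piLp fun a => ?_
  suffices h : ∀ σ : Equiv.Perm (Fin n),
      MemLp (fun p : Conf n => ∏ i, (s (σ i)).mode (p i) (a i).1 (a i).2) 2 (confMeasure q n) by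
    have h' := (memLp_finsetSum (f := fun (σ : Equiv.Perm (Fin n)) (p : Conf n) =>
      ∏ i, (s (σ i)).mode (p i) (a i).1 (a i).2) Finset.univ fun σ _ => h σ).const_mul
        (n.factorial : ℂ)⁻¹
    simpa only [symFun] using h'
  intro σ
  have hm : ∀ i, AEStronglyMeasurable (fun p : Conf n => (s (σ i)).mode (p i) (a i).1 (a i).2)
      (confMeasure q n) := fun i =>
    (memLp_mode (s (σ i)) (a i)).1.comp_quasiMeasurePreserving (Measure.quasiMeasurePreserving_eval _ i)
  rw [memLp_two_iff_integrable_sq_norm (Finset.aestronglyMeasurable_fun_prod _ fun i _ => hm i)]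
  simp only [norm_prod, ← Finset.prod_pow]
  exact Integrable.fintype_prod (f := fun i (y : ℝ × S2) => ‖(s (σ i)).mode y (a i).1 (a i).2‖ ^ 2)
    fun i => (memLp_mode (s (σ i)) (a i)).integrable_norm_pow (by simp)

/-- The symmetrised product of `n` one-particle states as an element of `L²`. -/
def symProduct {n : ℕ} (s : Fin n → TestTensor q) : Lp (Pol n) 2 (confMeasure q n) :=
  (memLp_symFun s).toLp _

end TestTensor

/-- The `n`-particle space: the closed span of the symmetrised products of one-particle states. -/
def NParticle (q : HorizonMetric) (n : ℕ) : Submodule ℂ (Lp (Pol n) 2 (confMeasure q n)) :=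
  (Submodule.span ℂ (Set.range (TestTensor.symProduct (q := q) (n := n)))).topologicalClosure

/-- The graviton Fock space. -/
abbrev Fock (q : HorizonMetric) := lp (fun n => NParticle q n) 2

instance (q n) : CompleteSpace (NParticle q n) := by unfold NParticle; infer_instance

theorem symProduct_mem {q : HorizonMetric} {n : ℕ} (s : Fin n → TestTensor q) :
    TestTensor.symProduct s ∈ NParticle q n :=
  Submodule.le_topologicalClosure _ (Submodule.subset_span ⟨s, rfl⟩)

/-- The vacuum vector. -/
def vacuum (q : HorizonMetric) : Fock q :=
  lp.single 2 0 ⟨TestTensor.symProduct Fin.elim0, symProduct_mem _⟩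

theorem norm_vacuum (q : HorizonMetric) : ‖vacuum q‖ = 1 := by
  have h : TestTensor.symFun (q := q) Fin.elim0 = fun _ => WithLp.toLp 2 fun _ => (1 : ℂ) := by
    ext p a; simp [TestTensor.symFun]
  rw [vacuum, lp.norm_single (by simp), Submodule.coe_norm]
  unfold TestTensor.symProduct
  rw [Lp.norm_toLp, h,
    eLpNorm_const' _ (by simp) (by simp)]
  simp [confMeasure, PiLp.norm_eq_of_L2]


theorem rotMatrix_refl : rotMatrix (LinearIsometryEquiv.refl ℝ E3) = 1 := by
  ext a b
  simp [rotMatrix, Matrix.one_apply]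

section DirectSum

variable {E : ℕ → Type*} [∀ n, NormedAddCommGroup (E n)] [∀ n, NormedSpace ℂ (E n)]

/-- The direct sum of isometries of Hilbert spaces. -/
def directSum (T : ∀ n, E n →ₗᵢ[ℂ] E n) : lp E 2 →ₗᵢ[ℂ] lp E 2 where
  toFun Ψ := ⟨fun n => T n (Ψ n), by
    have h := lp.memℓp Ψ
    show Memℓp (fun n => T n (Ψ n)) 2
    rw [memℓp_gen_iff (by simp)] at h ⊢
    simpa only [LinearIsometry.norm_map] using h⟩
  map_add' Ψ Φ := Subtype.ext (funext fun n => (T n).map_add _ _)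
  map_smul' c Ψ := Subtype.ext (funext fun n => (T n).map_smul _ _)
  norm_map' Ψ := by
    rw [lp.norm_eq_tsum_rpow (by simp), lp.norm_eq_tsum_rpow (by simp)]
    exact congrArg (· ^ (1 / (2 : ENNReal).toReal))
      (tsum_congr fun n => congrArg (· ^ _) ((T n).norm_map _))

end DirectSum

namespace Symmetry

variable {q : HorizonMetric} (g : Symmetry q) (κ : ℝ)

/-- The inverse of the motion of a particle under the symmetry, on pairs of a log-frequency and an
angle. -/
def flow (p : ℝ × S2) : ℝ × S2 := (p.1 + κ * g.f p.2, rotSphere g.rot.symm p.2)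

theorem measurePreserving_rot_symm : MeasurePreserving (rotSphere g.rot.symm) q.area q.area := by
  let e : S2 ≃ᵐ S2 :=
    { toFun := rotSphere g.rot
      invFun := rotSphere g.rot.symm
      left_inv := rotSphere_symm_rotSphere _
      right_inv := rotSphere_rotSphere_symm _
      measurable_toFun := (continuous_rotSphere _).measurable
      measurable_invFun := (continuous_rotSphere _).measurable }
  exact MeasurePreserving.symm e g.measurePreserving_area

theorem measurePreserving_flow : MeasurePreserving (g.flow κ)
    ((volume : Measure ℝ).prod q.area) ((volume : Measure ℝ).prod q.area) := by
  have hf : Measurable fun x : S2 => g.f x := g.f.contMDiff.continuous.measurable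
  have h := MeasurePreserving.skew_product (g := fun (x : S2) (L : ℝ) => L + κ * g.f x)
    (μc := (volume : Measure ℝ)) (μd := (volume : Measure ℝ))
    g.measurePreserving_rot_symm (by fun_prop)
    (.of_forall fun x => (measurePreserving_add_right volume (κ * g.f x)).map_eq)
  exact (Measure.measurePreserving_swap.comp h).comp Measure.measurePreserving_swap

/-- Rotation of the tensor indices of a one-particle wavefunction. -/
def pol (a c : Fin 3 × Fin 3) : ℂ := (rotMatrix g.rot a.1 c.1 * rotMatrix g.rot a.2 c.2 : ℝ)

theorem sum_pol (c d : Fin 3 × Fin 3) :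
    ∑ a, star (g.pol a c) * g.pol a d = if c = d then 1 else 0 := by
  have h := rotMatrix_transpose_mul g.rot
  have h1 : ∀ i j, ∑ a, rotMatrix g.rot a i * rotMatrix g.rot a j = if i = j then 1 else 0 :=
    fun i j => by
      have := congrFun (congrFun h i) j
      simpa [Matrix.mul_apply, Matrix.one_apply] using this
  have h2 : ∑ a : Fin 3 × Fin 3, (rotMatrix g.rot a.1 c.1 * rotMatrix g.rot a.2 c.2) *
      (rotMatrix g.rot a.1 d.1 * rotMatrix g.rot a.2 d.2)
      = (if c.1 = d.1 then 1 else 0) * (if c.2 = d.2 then 1 else 0) := by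
    rw [← h1, ← h1, Finset.sum_mul_sum, Fintype.sum_prod_type]
    exact Finset.sum_congr rfl fun _ _ => Finset.sum_congr rfl fun _ _ => by ring
  have h3 : ((∑ a : Fin 3 × Fin 3, (rotMatrix g.rot a.1 c.1 * rotMatrix g.rot a.2 c.2) *
      (rotMatrix g.rot a.1 d.1 * rotMatrix g.rot a.2 d.2) : ℝ) : ℂ)
      = ∑ a, star (g.pol a c) * g.pol a d := by
    rw [Complex.ofReal_sum]
    refine Finset.sum_congr rfl fun a _ => ?_
    simp [pol]
  rw [← h3, h2]
  rcases c with ⟨c1, c2⟩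
  rcases d with ⟨d1, d2⟩
  by_cases e1 : c1 = d1 <;> by_cases e2 : c2 = d2 <;> simp [e1, e2]

/-- Rotation of the tensor indices of an `n`-particle wavefunction. -/
def polMatrix (n : ℕ) : Matrix (Fin n → Fin 3 × Fin 3) (Fin n → Fin 3 × Fin 3) ℂ :=
  Matrix.of fun a c => ∏ i, g.pol (a i) (c i)

theorem polMatrix_star_mul (n : ℕ) : (g.polMatrix n).conjTranspose * g.polMatrix n = 1 := by
  ext c d
  simp only [Matrix.mul_apply, Matrix.conjTranspose_apply, polMatrix, Matrix.of_apply, star_prod,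
    ← Finset.prod_mul_distrib]
  rw [← Fintype.piFinset_univ, Finset.sum_prod_piFinset Finset.univ
    (fun i a => star (g.pol a (c i)) * g.pol a (d i))]
  simp only [sum_pol, Matrix.one_apply, Finset.prod_ite_zero, Finset.prod_const_one, funext_iff]
  simp

/-- Rotation of the tensor indices as an isometry. -/
def polIsometry (n : ℕ) : Pol n →ₗᵢ[ℂ] Pol n where
  toLinearMap := Matrix.toEuclideanLin (g.polMatrix n)
  norm_map' v := by
    have h : inner ℂ (Matrix.toEuclideanLin (g.polMatrix n) v) (Matrix.toEuclideanLin (g.polMatrix n) v)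
        = inner ℂ v v := by
      rw [← LinearMap.adjoint_inner_left, ← Matrix.toEuclideanLin_conjTranspose_eq_adjoint]
      congr 1
      rw [← LinearMap.comp_apply]
      have : Matrix.toEuclideanLin (g.polMatrix n).conjTranspose ∘ₗ Matrix.toEuclideanLin (g.polMatrix n)
        = Matrix.toEuclideanLin ((g.polMatrix n).conjTranspose * g.polMatrix n) := by
        ext w; simp [Matrix.toEuclideanLin]
      rw [this, polMatrix_star_mul]
      simp [Matrix.toEuclideanLin]
    rw [inner_self_eq_norm_sq_to_K, inner_self_eq_norm_sq_to_K] at h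
    have h' : ‖Matrix.toEuclideanLin (g.polMatrix n) v‖ ^ 2 = ‖v‖ ^ 2 := by exact_mod_cast h
    exact (sq_eq_sq₀ (norm_nonneg _) (norm_nonneg _)).1 h'

theorem polIsometry_apply {n : ℕ} (v : Pol n) (a : Fin n → Fin 3 × Fin 3) :
    g.polIsometry n v a = ∑ c, (∏ i, g.pol (a i) (c i)) * v c := rfl

theorem measurePreserving_flow_pi (n : ℕ) : MeasurePreserving (fun (p : Conf n) i => g.flow κ (p i))
    (confMeasure q n) (confMeasure q n) :=
  measurePreserving_pi _ _ fun _ => g.measurePreserving_flow κ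

/-- The action of a symmetry on `n`-particle wavefunctions; by `ambientAct_symProduct` it extends
the action on test tensors. -/
def ambientAct (n : ℕ) : Lp (Pol n) 2 (confMeasure q n) →ₗᵢ[ℂ] Lp (Pol n) 2 (confMeasure q n) where
  toLinearMap := ((g.polIsometry n).toContinuousLinearMap.compLpL 2 (confMeasure q n)).toLinearMap ∘ₗ
    (Lp.compMeasurePreservingₗ ℂ _ (g.measurePreserving_flow_pi κ n))
  norm_map' ψ := by
    rw [← Lp.norm_compMeasurePreserving ψ (g.measurePreserving_flow_pi κ n)]
    set φ := Lp.compMeasurePreserving _ (g.measurePreserving_flow_pi κ n) ψ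
    have h : ∀ᵐ p ∂(confMeasure q n),
        ‖((g.polIsometry n).toContinuousLinearMap.compLp φ) p‖ = ‖φ p‖ := by
      filter_upwards [(g.polIsometry n).toContinuousLinearMap.coeFn_compLp φ] with p hp
      rw [hp]; exact (g.polIsometry n).norm_map _
    exact le_antisymm (Lp.norm_le_norm_of_ae_le (h.mono fun _ h => h.le))
      (Lp.norm_le_norm_of_ae_le (h.mono fun _ h => h.ge))

theorem ambientAct_ae (n : ℕ) (ψ : Lp (Pol n) 2 (confMeasure q n)) :
    g.ambientAct κ n ψ =ᵐ[confMeasure q n]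
      fun p => g.polIsometry n (ψ fun i => g.flow κ (p i)) := by
  have h1 := (g.polIsometry n).toContinuousLinearMap.coeFn_compLp
    (Lp.compMeasurePreserving _ (g.measurePreserving_flow_pi κ n) ψ)
  have h2 := Lp.coeFn_compMeasurePreserving ψ (g.measurePreserving_flow_pi κ n)
  refine EventuallyEq.trans (show _ =ᵐ[confMeasure q n] _ from h1) ?_
  filter_upwards [h2] with p hp
  rw [hp]; rfl

theorem mode_actTest (s : TestTensor q) (p : ℝ × S2) :
    (g.actTest κ s).mode p = (rotMatrix g.rot).map Complex.ofReal * s.mode (g.flow κ p) *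
      (rotMatrix g.rot).transpose.map Complex.ofReal := by
  obtain ⟨L, x⟩ := p
  set M := rotMatrix g.rot with hM
  set y := rotSphere g.rot.symm x with hy
  set Y : Matrix (Fin 3) (Fin 3) ℂ := Matrix.of (fun a b =>
    ((Real.exp (L + κ * g.f x) / √Real.pi : ℝ) : ℂ) *
      fourier (fun y => s.toFun y.1 y.2 a b) (Real.exp (L + κ * g.f x)) y) with hY
  have hm : ∀ A B : Matrix (Fin 3) (Fin 3) ℝ, (A * B).map Complex.ofReal
        = A.map Complex.ofReal * B.map Complex.ofReal := fun A B => Matrix.map_mul (f := Complex.ofRealHom)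
  have h1 : Matrix.of (fun a b => ((Real.exp L / √Real.pi : ℝ) : ℂ) *
      fourier (fun y => (g.actTest κ s).toFun y.1 y.2 a b) (Real.exp L) x)
      = M.map Complex.ofReal * Y * M.transpose.map Complex.ofReal := by
    have hscale : ∀ c d, fourier (fun z => s.toFun (Real.exp (-(κ * g.f z.2)) * z.1)
        (rotSphere g.rot.symm z.2) c d) (Real.exp L) x
        = (Real.exp (κ * g.f x) : ℂ) *
          fourier (fun y => s.toFun y.1 y.2 c d) (Real.exp (L + κ * g.f x)) y := fun c d => by
      have := Measure.integral_comp_mul_left (fun U : ℝ => s.toFun U y c d *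
        Complex.exp (Complex.I * ((Real.exp (L + κ * g.f x) : ℝ) * U))) (Real.exp (-(κ * g.f x)))
      rw [← Real.exp_neg, neg_neg, abs_of_pos (Real.exp_pos _), Complex.real_smul] at this
      unfold fourier
      rw [← this]
      refine integral_congr_ae (.of_forall fun U => ?_)
      simp only
      have he : Real.exp L * U = Real.exp (L + κ * g.f x) * (Real.exp (-(κ * g.f x)) * U) := by
        rw [← mul_assoc, ← Real.exp_add]; congr 2; ring
      have he' : (Real.exp L : ℂ) * (U : ℂ)
          = (Real.exp (L + κ * g.f x) : ℝ) * ((Real.exp (-(κ * g.f x)) * U : ℝ) : ℂ) := by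
        rw [← Complex.ofReal_mul, ← Complex.ofReal_mul, ← he]
      rw [he']
    ext a b
    rw [Matrix.of_apply]
    have hint : ∀ c d, Integrable fun U : ℝ => s.toFun (Real.exp (-(κ * g.f x)) * U) y c d *
        Complex.exp (Complex.I * ((Real.exp L : ℝ) * U)) := fun c d => by
      have h := ((s.isTest c d).integrable_slice y).comp_mul_left'
        (Real.exp_pos (-(κ * g.f x))).ne'
      exact h.mul_bdd (c := 1) (by fun_prop) (.of_forall fun U => (norm_phase _ U).le)
    have hL : fourier (fun y => (g.actTest κ s).toFun y.1 y.2 a b) (Real.exp L) x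
        = ∑ d, ∑ c, M.map Complex.ofReal a c *
          fourier (fun z => s.toFun (Real.exp (-(κ * g.f z.2)) * z.1)
            (rotSphere g.rot.symm z.2) c d) (Real.exp L) x * M.transpose.map Complex.ofReal d b := by
      unfold fourier
      simp only [← integral_const_mul, ← integral_mul_const]
      have hI : ∀ d c, Integrable fun U : ℝ => M.map Complex.ofReal a c *
          (s.toFun (Real.exp (-(κ * g.f x)) * U) y c d *
            Complex.exp (Complex.I * ((Real.exp L : ℝ) * U))) * M.transpose.map Complex.ofReal d b :=
        fun d c => ((hint c d).const_mul _).mul_const _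
      have hS : ∀ d, Integrable fun U : ℝ => ∑ c, M.map Complex.ofReal a c *
          (s.toFun (Real.exp (-(κ * g.f x)) * U) y c d *
            Complex.exp (Complex.I * ((Real.exp L : ℝ) * U))) * M.transpose.map Complex.ofReal d b :=
        fun d => integrable_finsetSum _ fun c _ => hI d c
      refine Eq.trans ?_ ((integral_finsetSum Finset.univ fun d _ => hS d).trans
        (Finset.sum_congr rfl fun d _ => integral_finsetSum Finset.univ fun c _ => hI d c))
      refine integral_congr_ae (.of_forall fun U => ?_)
      have hU : (g.actTest κ s).toFun U x a b = ∑ d, ∑ c, M.map Complex.ofReal a c *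
          s.toFun (Real.exp (-(κ * g.f x)) * U) y c d * M.transpose.map Complex.ofReal d b := by
        simp only [actTest, Matrix.mul_apply, Finset.sum_mul, hM, hy]
      simp only [hU, Finset.sum_mul]
      refine Finset.sum_congr rfl fun d _ => Finset.sum_congr rfl fun c _ => ?_
      ring
    rw [hL]
    simp only [hscale]
    simp only [Matrix.mul_apply, hY, Matrix.of_apply, Finset.mul_sum, Finset.sum_mul]
    refine Finset.sum_congr rfl fun d _ => Finset.sum_congr rfl fun c _ => ?_
    rw [Real.exp_add]
    push_cast
    ring
  have hfr : (q.frame x).map Complex.ofReal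
      = M.map Complex.ofReal * (q.frame y).map Complex.ofReal * M.transpose.map Complex.ofReal := by
    rw [← hm, ← hm, ← g.frame_rot, hy, rotSphere_rotSphere_symm]
  have ho : M.transpose.map Complex.ofReal * M.map Complex.ofReal = 1 := by
    rw [← hm, rotMatrix_transpose_mul]; simp
  have ho' : ∀ Z : Matrix (Fin 3) (Fin 3) ℂ, M.transpose.map Complex.ofReal * (M.map Complex.ofReal * Z)
    = Z := fun Z => by rw [← mul_assoc, ho, one_mul]
  have hl : (g.actTest κ s).mode (L, x) = (q.frame x).map Complex.ofReal *
      (M.map Complex.ofReal * Y * M.transpose.map Complex.ofReal) * (q.frame x).map Complex.ofReal := by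
    rw [← h1]; rfl
  have hr : s.mode (g.flow κ (L, x)) = (q.frame y).map Complex.ofReal * Y *
    (q.frame y).map Complex.ofReal := rfl
  rw [hl, hr, hfr]
  simp only [mul_assoc, ho']

theorem symFun_actTest {n : ℕ} (s : Fin n → TestTensor q) (p : Conf n) :
    TestTensor.symFun (fun i => g.actTest κ (s i)) p =
      g.polIsometry n (TestTensor.symFun s fun i => g.flow κ (p i)) := by
  ext a
  rw [polIsometry_apply]
  simp only [TestTensor.symFun]
  have h : ∀ (t : TestTensor q) (r : ℝ × S2) (b : Fin 3 × Fin 3),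
      (g.actTest κ t).mode r b.1 b.2 = ∑ c : Fin 3 × Fin 3, g.pol b c * t.mode (g.flow κ r) c.1 c.2 := by
    intro t r b
    rw [mode_actTest, Matrix.mul_apply, Fintype.sum_prod_type_right]
    refine Finset.sum_congr rfl fun d _ => ?_
    rw [Matrix.mul_apply, Finset.sum_mul]
    refine Finset.sum_congr rfl fun c _ => ?_
    simp [pol]; ring
  simp only [h]
  simp only [Finset.prod_univ_sum, Fintype.piFinset_univ, Finset.prod_mul_distrib]
  rw [Finset.sum_comm, Finset.mul_sum]
  refine Finset.sum_congr rfl fun c _ => ?_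
  rw [Finset.mul_sum, Finset.mul_sum, Finset.mul_sum]
  refine Finset.sum_congr rfl fun σ _ => ?_
  ring

theorem ambientAct_symProduct {n : ℕ} (s : Fin n → TestTensor q) :
    g.ambientAct κ n (TestTensor.symProduct s) =
      TestTensor.symProduct fun i => g.actTest κ (s i) := by
  refine Lp.ext ?_
  have h1 := g.ambientAct_ae κ n (TestTensor.symProduct s)
  have h2 := (TestTensor.memLp_symFun s).coeFn_toLp
  have h3 := (TestTensor.memLp_symFun fun i => g.actTest κ (s i)).coeFn_toLp
  have h4 := (g.measurePreserving_flow_pi κ n).quasiMeasurePreserving.ae_eq_comp h2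
  refine h1.trans (EventuallyEq.trans ?_ h3.symm)
  filter_upwards [h4] with p hp
  rw [symFun_actTest]
  exact congrArg _ hp

theorem ambientAct_mem {n : ℕ} {ψ : Lp (Pol n) 2 (confMeasure q n)} (hψ : ψ ∈ NParticle q n) :
    g.ambientAct κ n ψ ∈ NParticle q n := by
  have h : Set.MapsTo (g.ambientAct κ n)
      (Submodule.span ℂ (Set.range (TestTensor.symProduct (q := q) (n := n))))
      (NParticle q n) := by
    intro ψ hψ
    induction hψ using Submodule.span_induction with
    | mem ψ h =>
      obtain ⟨s, rfl⟩ := h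
      rw [ambientAct_symProduct]
      exact symProduct_mem _
    | zero => simp
    | add ψ φ _ _ h1 h2 => rw [map_add]; exact add_mem h1 h2
    | smul c ψ _ h => rw [map_smul]; exact Submodule.smul_mem _ _ h
  have hc := h.closure (g.ambientAct κ n).continuous
  have : IsClosed (NParticle q n : Set (Lp (Pol n) 2 (confMeasure q n))) :=
    Submodule.isClosed_topologicalClosure _
  rw [this.closure_eq] at hc
  exact hc hψ

/-- The action of a symmetry on the `n`-particle space. -/
def actN (n : ℕ) : NParticle q n →ₗᵢ[ℂ] NParticle q n where
  toLinearMap := (g.ambientAct κ n).toLinearMap.restrict fun _ h => g.ambientAct_mem κ h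
  norm_map' ψ := (g.ambientAct κ n).norm_map ψ

/-- The action of a symmetry on the Fock space. -/
def act : Fock q →ₗᵢ[ℂ] Fock q := directSum fun n => g.actN κ n

theorem act_apply (Ψ : Fock q) (n : ℕ) : (g.act κ Ψ : ∀ n, NParticle q n) n
    = g.actN κ n ((Ψ : ∀ n, NParticle q n) n) := rfl

/-- A boost supertranslation, without rotation. -/
def boost (q : HorizonMetric) (f : Supertranslation) : Symmetry q where
  f := f
  rot := LinearIsometryEquiv.refl ℝ E3
  det_rot := by rw [rotMatrix_refl, Matrix.det_one]
  isometry x := by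
    have : rotSphere (LinearIsometryEquiv.refl ℝ E3) x = x := rfl
    rw [rotMatrix_refl, this]; simp

end Symmetry

section States

variable {q : HorizonMetric}

/-- The state `Ψ` is invariant under the boost supertranslation `u ↦ u + f`. Vectors that differ by
a scalar represent the same state. -/
def IsInvariant (κ : ℝ) (f : Supertranslation) (Ψ : Fock q) : Prop :=
  ∃ c : ℂ, (Symmetry.boost q f).act κ Ψ = c • Ψ

/-- The unit vector `Ψ` represents the vacuum state. -/
def IsVacuumState (Ψ : Fock q) : Prop := ∃ z : ℂ, ‖z‖ = 1 ∧ Ψ = z • vacuum q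

/-- Every multi-particle wavefunction of `Ψ` has a continuous representative. -/
def HasContinuousWavefunctions (Ψ : Fock q) : Prop :=
  ∀ n, ∃ φ : Conf n → Pol n, Continuous φ ∧
    (((Ψ : ∀ n, NParticle q n) n : Lp (Pol n) 2 (confMeasure q n)) : Conf n → Pol n)
      =ᵐ[confMeasure q n] φ

/-- The linear span of the pure boost supertranslations contained in a set (usually a subgroup) of
horizon symmetries. -/
def boostPart (K : Set (Symmetry q)) : Submodule ℝ Supertranslation :=
  Submodule.span ℝ {f | Symmetry.boost q f ∈ K}

/-- The criterion for consistently restricting to the symmetries `K`: some normalized state other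
than the vacuum is invariant under the remaining boost supertranslations, which are realised by a
linear complement `W` of those in `K`. -/
def AdmitsNontrivialRestriction (κ : ℝ) (K : Set (Symmetry q)) : Prop :=
  ∃ W : Submodule ℝ Supertranslation, IsCompl (boostPart K) W ∧
    ∃ Ψ : Fock q, ‖Ψ‖ = 1 ∧ (∀ f ∈ W, IsInvariant κ f Ψ) ∧ ¬ IsVacuumState Ψ

end States

theorem integrable_weight {ε : ℝ} (hε : 0 < ε) :
    IntegrableOn (fun k : ℝ => (k : ℂ) * Complex.exp (-(ε * k))) (Set.Ioi 0) := by
  have h := integrableOn_rpow_mul_exp_neg_mul_rpow (s := 1) (p := 1) (b := ε) (by norm_num) (by norm_num) hε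
  have := h.ofReal (𝕜 := ℂ)
  refine this.congr (.of_forall fun k => ?_)
  simp

theorem kernel_eq {ε : ℝ} (hε : 0 < ε) (w : ℝ) :
    ∫ k : ℝ in Set.Ioi 0, (k : ℂ) * Complex.exp (-((ε + Complex.I * w) * k))
      = -1 / ((w : ℂ) - Complex.I * ε) ^ 2 := by
  set r : ℂ := ε + Complex.I * w with hr
  have hre : r.re = ε := by simp [hr]
  have hr0 : r ≠ 0 := fun h => by rw [h] at hre; exact hε.ne (by simpa using hre)
  have hn : ∀ k : ℝ, ‖Complex.exp (-(r * k))‖ = Real.exp (-(ε * k)) := fun k => by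
    rw [Complex.norm_exp]; simp [hre]
  have hder : ∀ k : ℝ, HasDerivAt (fun k : ℝ => -((k : ℂ) / r + 1 / r ^ 2) * Complex.exp (-(r * k)))
      ((k : ℂ) * Complex.exp (-(r * k))) k := fun k => by
    have h1 : HasDerivAt (fun k : ℝ => (k : ℂ)) 1 k := Complex.ofRealCLM.hasDerivAt
    have h2 := ((h1.div_const r).add_const (1 / r ^ 2)).neg.mul ((h1.const_mul r).neg.cexp)
    refine h2.congr_deriv ?_
    simp only [Pi.neg_apply]
    field_simp
    ring
  have hi : IntegrableOn (fun k : ℝ => (k : ℂ) * Complex.exp (-(r * k))) (Set.Ioi 0) := by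
    refine Integrable.mono (integrable_weight hε) (Continuous.aestronglyMeasurable (by fun_prop))
      (.of_forall fun k => ?_)
    rw [norm_mul, norm_mul, hn, Complex.norm_exp]
    simp
  have hlim : Tendsto (fun k : ℝ => -((k : ℂ) / r + 1 / r ^ 2) * Complex.exp (-(r * k))) atTop (𝓝 0) := by
    have h0 : Tendsto (fun k : ℝ => Real.exp (-(ε * k))) atTop (𝓝 0) :=
      Real.tendsto_exp_neg_atTop_nhds_zero.comp (tendsto_id.const_mul_atTop hε)
    have h1 : Tendsto (fun k : ℝ => k * Real.exp (-(ε * k))) atTop (𝓝 0) := by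
      have := (Real.tendsto_pow_mul_exp_neg_atTop_nhds_zero 1).comp (tendsto_id.const_mul_atTop hε)
      have := this.const_mul ε⁻¹
      rw [mul_zero] at this
      refine this.congr fun k => ?_
      simp only [Function.comp, id, pow_one]
      field_simp
    have h2 := (h1.mul_const ‖r‖⁻¹).add (h0.mul_const ‖1 / r ^ 2‖)
    rw [zero_mul, zero_mul, add_zero] at h2
    refine squeeze_zero_norm' ?_ h2
    filter_upwards [eventually_ge_atTop 0] with k hk
    rw [norm_mul, norm_neg, hn]
    refine (mul_le_mul_of_nonneg_right (norm_add_le _ _) (Real.exp_nonneg _)).trans_eq ?_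
    rw [norm_div, Complex.norm_real, Real.norm_of_nonneg hk]
    ring
  have := integral_Ioi_of_hasDerivAt_of_tendsto (a := 0) (hder 0).continuousAt.continuousWithinAt
    (fun k _ => hder k) hi hlim
  rw [this]
  have h3 : r = Complex.I * (w - Complex.I * ε) := by
    rw [hr]; linear_combination (ε : ℂ) * Complex.I_sq
  have h4 : r ^ 2 = -((w : ℂ) - Complex.I * ε) ^ 2 := by
    rw [h3, mul_pow, Complex.I_sq]; ring
  rw [h4]
  simp [neg_div, div_neg]

theorem integral_exp_subst (h : ℝ → ℂ) :
    ∫ k in Set.Ioi 0, h k = ∫ L : ℝ, (Real.exp L : ℂ) * h (Real.exp L) := by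
  have := integral_image_eq_integral_abs_deriv_smul (s := Set.univ) (f := Real.exp)
    (f' := Real.exp) MeasurableSet.univ (fun x _ => (Real.hasDerivAt_exp x).hasDerivWithinAt)
    Real.exp_injective.injOn h
  rw [Set.image_univ, Real.range_exp, setIntegral_univ] at this
  rw [this]
  refine integral_congr_ae (.of_forall fun x => ?_)
  simp [abs_of_pos (Real.exp_pos x)]

theorem twoPoint_slice {φ ψ : ℝ → ℂ} (hφ : Integrable φ) (hψ : Integrable ψ) {ε : ℝ} (hε : 0 < ε) :
    ∫ U₁ : ℝ, ∫ U₂ : ℝ, -1 / ((U₁ : ℂ) - U₂ - Complex.I * ε) ^ 2 * (star (φ U₁) * ψ U₂)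
      = ∫ k : ℝ in Set.Ioi 0, ((k : ℂ) * Complex.exp (-(ε * k))) *
        (star (∫ U, φ U * Complex.exp (Complex.I * (k * U))) *
          ∫ U, ψ U * Complex.exp (Complex.I * (k * U))) := by
  set K : ℝ → ℂ := fun k => (k : ℂ) * Complex.exp (-(ε * k)) with hK
  have hKi := integrable_weight hε
  have h1 : ∀ U₁ : ℝ, ∫ U₂ : ℝ, -1 / ((U₁ : ℂ) - U₂ - Complex.I * ε) ^ 2 * (star (φ U₁) * ψ U₂)
      = ∫ k : ℝ in Set.Ioi 0, star (φ U₁) * (K k * Complex.exp (-(Complex.I * (k * U₁))) *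
          ∫ U, ψ U * Complex.exp (Complex.I * (k * U))) := by
    intro U₁
    have : ∀ U₂ : ℝ, -1 / ((U₁ : ℂ) - U₂ - Complex.I * ε) ^ 2 * (star (φ U₁) * ψ U₂)
        = ∫ k : ℝ in Set.Ioi 0, star (φ U₁) * (K k * Complex.exp (-(Complex.I * (k * U₁))) *
          (ψ U₂ * Complex.exp (Complex.I * (k * U₂)))) := by
      intro U₂
      have := kernel_eq hε (U₁ - U₂)
      push_cast at this
      rw [← this, ← integral_mul_const]
      refine integral_congr_ae (.of_forall fun k => ?_)
      simp only [hK]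
      rw [show -(((ε : ℂ) + Complex.I * (U₁ - U₂)) * k) = -(ε * k) + -(Complex.I * (k * U₁))
        + Complex.I * (k * U₂) by ring, Complex.exp_add, Complex.exp_add]
      ring
    simp only [this]
    rw [integral_integral_swap]
    · simp only [integral_const_mul]
    · have hp := (hψ.mul_prod (hKi)).const_mul (star (φ U₁))
      have hb := hp.mul_bdd (c := 1) (g := fun z : ℝ × ℝ => Complex.exp (Complex.I * (z.2 * z.1))
        * Complex.exp (-(Complex.I * (z.2 * U₁)))) (by fun_prop) (.of_forall fun z => by
          rw [norm_mul, norm_phase, Complex.exp_neg, norm_inv, norm_phase]; simp)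
      refine hb.congr (.of_forall fun z => ?_)
      simp only [Function.uncurry, hK]; ring
  simp only [h1]
  rw [integral_integral_swap]
  · refine integral_congr_ae (.of_forall fun k => ?_)
    simp only
    have hs : star (∫ U, φ U * Complex.exp (Complex.I * (k * U)))
        = ∫ U, star (φ U) * Complex.exp (-(Complex.I * (k * U))) := by
      rw [show (star : ℂ → ℂ) = starRingEnd ℂ from rfl, ← integral_conj]
      refine integral_congr_ae (.of_forall fun U => ?_)
      simp only [map_mul, ← Complex.exp_conj, Complex.conj_I, Complex.conj_ofReal, neg_mul]
    rw [hs, ← integral_mul_const, ← integral_const_mul]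
    refine integral_congr_ae (.of_forall fun U => ?_)
    simp only; ring
  · have hc : Continuous fun k : ℝ => ∫ U, ψ U * Complex.exp (Complex.I * (k * U)) := by
      refine continuous_of_dominated (bound := fun U => ‖ψ U‖) (fun k => ?_) (fun k => .of_forall fun U => ?_) hψ.norm
        (.of_forall fun U => by fun_prop)
      · exact hψ.1.mul (Continuous.aestronglyMeasurable (by fun_prop))
      · rw [norm_mul, norm_phase, mul_one]
    have hφs : Integrable fun U => star (φ U) :=
      (integrable_norm_iff (continuous_star.comp_aestronglyMeasurable hφ.1)).1 (by simpa using hφ.norm)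
    have hp := hφs.mul_prod hKi
    have hb := hp.mul_bdd (c := ∫ U, ‖ψ U‖) (g := fun z : ℝ × ℝ =>
      Complex.exp (-(Complex.I * (z.2 * z.1))) * ∫ U, ψ U * Complex.exp (Complex.I * (z.2 * U)))
      (Continuous.aestronglyMeasurable ((by fun_prop : Continuous fun z : ℝ × ℝ =>
        Complex.exp (-(Complex.I * (z.2 * z.1)))).mul (hc.comp continuous_snd))) (.of_forall fun z => by
          rw [norm_mul, Complex.exp_neg, norm_inv, norm_phase, inv_one, one_mul]
          refine (norm_integral_le_integral_norm _).trans_eq ?_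
          simp only [norm_mul, norm_phase, mul_one])
    refine hb.congr (.of_forall fun z => ?_)
    simp only [Function.uncurry]; ring


theorem norm_kernel_le {ε : ℝ} (hε : 0 < ε) (w : ℝ) :
    ‖-1 / ((w : ℂ) - Complex.I * ε) ^ 2‖ ≤ 1 / ε ^ 2 := by
  have h := Complex.abs_im_le_norm ((w : ℂ) - Complex.I * ε)
  simp only [Complex.sub_im, Complex.ofReal_im, Complex.mul_im, Complex.I_re, Complex.I_im,
    Complex.ofReal_re, zero_mul, one_mul, zero_add, zero_sub, abs_neg, abs_of_pos hε] at h
  rw [norm_div, norm_neg, norm_one, norm_pow]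
  gcongr

theorem integrable_kernel {φ ψ : ℝ → ℂ} (hφ : Integrable φ) (hψ : Integrable ψ) {ε : ℝ}
    (hε : 0 < ε) : Integrable fun U : ℝ × ℝ =>
      -1 / ((U.1 : ℂ) - U.2 - Complex.I * ε) ^ 2 * (star (φ U.1) * ψ U.2) := by
  have hφs : Integrable fun U => star (φ U) :=
    (integrable_norm_iff (continuous_star.comp_aestronglyMeasurable hφ.1)).1 (by simpa using hφ.norm)
  refine (hφs.mul_prod hψ).bdd_mul (c := 1 / ε ^ 2) ?_ (.of_forall fun U => ?_)
  · exact Measurable.aestronglyMeasurable (by fun_prop)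
  · have := norm_kernel_le hε (U.1 - U.2)
    push_cast at this
    exact this

theorem integrable_spectral {φ ψ : ℝ → ℂ} (hφ : Integrable φ) (hψ : Integrable ψ) {ε : ℝ}
    (hε : 0 < ε) : IntegrableOn (fun k : ℝ => ((k : ℂ) * Complex.exp (-(ε * k))) *
        (star (∫ U, φ U * Complex.exp (Complex.I * (k * U))) *
          ∫ U, ψ U * Complex.exp (Complex.I * (k * U)))) (Set.Ioi 0) := by
  have hc : ∀ {ψ : ℝ → ℂ}, Integrable ψ →
      Continuous fun k : ℝ => ∫ U, ψ U * Complex.exp (Complex.I * (k * U)) := fun {ψ} hψ => by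
    refine continuous_of_dominated (bound := fun U => ‖ψ U‖) (fun k => ?_)
      (fun k => .of_forall fun U => ?_) hψ.norm (.of_forall fun U => by fun_prop)
    · exact hψ.1.mul (Continuous.aestronglyMeasurable (by fun_prop))
    · rw [norm_mul, norm_phase, mul_one]
  have hb : ∀ (ψ : ℝ → ℂ) (k : ℝ), ‖∫ U, ψ U * Complex.exp (Complex.I * (k * U))‖ ≤ ∫ U, ‖ψ U‖ :=
    fun ψ k => (norm_integral_le_integral_norm _).trans_eq (by simp only [norm_mul, norm_phase, mul_one])
  refine Integrable.mul_bdd (c := (∫ U, ‖φ U‖) * ∫ U, ‖ψ U‖) (integrable_weight hε)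
    (Continuous.aestronglyMeasurable ((continuous_star.comp (hc hφ)).mul (hc hψ)))
    (.of_forall fun k => ?_)
  rw [norm_mul, norm_star]
  have := hb φ k
  have := hb ψ k
  gcongr

theorem integral_kernel {φ ψ : ℝ → ℂ} (hφ : Integrable φ) (hψ : Integrable ψ) {ε : ℝ}
    (hε : 0 < ε) : ∫ U : ℝ × ℝ, -1 / ((U.1 : ℂ) - U.2 - Complex.I * ε) ^ 2 * (star (φ U.1) * ψ U.2)
      = ∫ k : ℝ in Set.Ioi 0, ((k : ℂ) * Complex.exp (-(ε * k))) *
        (star (∫ U, φ U * Complex.exp (Complex.I * (k * U))) *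
          ∫ U, ψ U * Complex.exp (Complex.I * (k * U))) := by
  rw [← twoPoint_slice hφ hψ hε]
  exact integral_prod _ (integrable_kernel hφ hψ hε)

section TwoPoint

variable {q : HorizonMetric}

theorem HorizonMetric.pairing_expand (q : HorizonMetric) (x : S2) (A B : Matrix (Fin 3) (Fin 3) ℂ) :
    ((q.metric x).map Complex.ofReal * A.map star * (q.metric x).map Complex.ofReal * B).trace
      = ∑ i : (Fin 3 × Fin 3) × (Fin 3 × Fin 3),
        ((q.metric x i.1.1 i.1.2 * q.metric x i.2.1 i.2.2 : ℝ) : ℂ) *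
          (star (A i.1.2 i.2.1) * B i.2.2 i.1.1) := by
  simp only [Matrix.trace, Matrix.diag, Matrix.mul_apply, Matrix.map_apply, Fintype.sum_prod_type,
    Fin.sum_univ_three]
  push_cast
  ring

/-- The Fourier transform of a test tensor. -/
def TestTensor.fourier (s : TestTensor q) (k : ℝ) (x : S2) : Matrix (Fin 3) (Fin 3) ℂ :=
  Matrix.of fun a b => Horizon.fourier (fun y => s.toFun y.1 y.2 a b) k x

theorem TestTensor.sum_mode (s t : TestTensor q) (L : ℝ) (x : S2) :
    ∑ i : Fin 3 × Fin 3, star (s.mode (L, x) i.1 i.2) * t.mode (L, x) i.1 i.2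
      = (((Real.exp L) ^ 2 / Real.pi : ℝ) : ℂ) *
        ((q.metric x).map Complex.ofReal * (s.fourier (Real.exp L) x).map star *
          (q.metric x).map Complex.ofReal * t.fourier (Real.exp L) x).trace := by
  set e := (q.frame x).map Complex.ofReal with he
  set c : ℂ := ((Real.exp L / √Real.pi : ℝ) : ℂ) with hc
  have hmode : ∀ r : TestTensor q, r.mode (L, x) = c • (e * r.fourier (Real.exp L) x * e) := by
    intro r
    have : r.mode (L, x) = e * (c • r.fourier (Real.exp L) x) * e := rfl
    rw [this]; simp
  have hherm : e.conjTranspose = e := by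
    have := (q.frame_posSemidef x).1
    ext a b
    have := congrFun (congrFun this a) b
    simp only [Matrix.conjTranspose_apply, star_trivial] at this
    simp [he, this]
  have hsym : (s.fourier (Real.exp L) x).conjTranspose = (s.fourier (Real.exp L) x).map star := by
    ext a b
    simp only [Matrix.conjTranspose_apply, Matrix.map_apply, TestTensor.fourier, Matrix.of_apply]
    congr 2
    funext y
    exact congrFun (congrFun (s.symm y.1 y.2) a) b
  have hee : (q.metric x).map Complex.ofReal = e * e := by
    rw [he, ← q.frame_mul_frame]; exact Matrix.map_mul (f := Complex.ofRealHom)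
  have hcc : star c * c = (((Real.exp L) ^ 2 / Real.pi : ℝ) : ℂ) := by
    rw [hc, show star ((Real.exp L / √Real.pi : ℝ) : ℂ) = ((Real.exp L / √Real.pi : ℝ) : ℂ) from
      Complex.conj_ofReal _, ← Complex.ofReal_mul]
    congr 1
    rw [← sq, div_pow, Real.sq_sqrt Real.pi_pos.le]
  have h1 : ∑ i : Fin 3 × Fin 3, star (s.mode (L, x) i.1 i.2) * t.mode (L, x) i.1 i.2
      = ((s.mode (L, x)).conjTranspose * t.mode (L, x)).trace := by
    rw [Fintype.sum_prod_type_right]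
    simp only [Matrix.trace, Matrix.diag, Matrix.mul_apply, Matrix.conjTranspose_apply]
  rw [h1, hmode, hmode, Matrix.conjTranspose_smul, Matrix.smul_mul, Matrix.mul_smul, smul_smul, hcc,
    Matrix.trace_smul, smul_eq_mul, Matrix.conjTranspose_mul, Matrix.conjTranspose_mul, hherm, hsym,
    hee]
  congr 1
  rw [← mul_assoc, Matrix.trace_mul_comm]
  simp only [mul_assoc]

theorem twoPoint_angle (s t : TestTensor q) {ε : ℝ} (hε : 0 < ε) (x : S2) :
    ∫ U : ℝ × ℝ, -(1 / Real.pi : ℂ) *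
        ((q.metric x).map Complex.ofReal * (s.toFun U.1 x).map star *
          (q.metric x).map Complex.ofReal * t.toFun U.2 x).trace /
        ((U.1 : ℂ) - U.2 - Complex.I * ε) ^ 2
      = ∫ L : ℝ, Complex.exp (-(ε * Real.exp L)) *
        ∑ i : Fin 3 × Fin 3, star (s.mode (L, x) i.1 i.2) * t.mode (L, x) i.1 i.2 := by
  have hφ := fun a b => (s.isTest a b).integrable_slice x
  have hψ := fun a b => (t.isTest a b).integrable_slice x
  set c : (Fin 3 × Fin 3) × (Fin 3 × Fin 3) → ℂ := fun i =>
    ((q.metric x i.1.1 i.1.2 * q.metric x i.2.1 i.2.2 : ℝ) : ℂ) with hc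
  have hl : ∀ U : ℝ × ℝ, -(1 / Real.pi : ℂ) *
        ((q.metric x).map Complex.ofReal * (s.toFun U.1 x).map star *
          (q.metric x).map Complex.ofReal * t.toFun U.2 x).trace /
        ((U.1 : ℂ) - U.2 - Complex.I * ε) ^ 2
      = ∑ i, (1 / Real.pi : ℂ) * c i * (-1 / ((U.1 : ℂ) - U.2 - Complex.I * ε) ^ 2 *
        (star (s.toFun U.1 x i.1.2 i.2.1) * t.toFun U.2 x i.2.2 i.1.1)) := fun U => by
    rw [q.pairing_expand, Finset.mul_sum, Finset.sum_div]
    refine Finset.sum_congr rfl fun i _ => ?_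
    ring
  simp only [hl]
  rw [integral_finsetSum _ fun i _ => (integrable_kernel (hφ i.1.2 i.2.1) (hψ i.2.2 i.1.1) hε).const_mul _]
  simp only [integral_const_mul]
  simp only [integral_kernel (hφ _ _) (hψ _ _) hε]
  refine (Finset.sum_congr rfl fun i _ => (integral_const_mul _ _).symm).trans ?_
  refine (integral_finsetSum _ fun i _ =>
    (integrable_spectral (hφ i.1.2 i.2.1) (hψ i.2.2 i.1.1) hε).const_mul _).symm.trans ?_
  rw [integral_exp_subst]
  refine integral_congr_ae (.of_forall fun L => ?_)
  simp only [s.sum_mode, q.pairing_expand, Finset.mul_sum]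
  refine Finset.sum_congr rfl fun i _ => ?_
  simp only [TestTensor.fourier, Horizon.fourier, Matrix.of_apply, hc]
  push_cast
  ring

/-- The smeared vacuum two-point function, before removing the regulator `ε`:
`-(1/π) ∫ dS ∫ dU₁ dU₂ q_{AC} q_{BD} conj (s^{AB}(U₁)) t^{CD}(U₂) / (U₁ - U₂ - i ε)²`. -/
def twoPoint (s t : TestTensor q) (ε : ℝ) : ℂ :=
  ∫ x, (∫ U : ℝ × ℝ, -(1 / Real.pi : ℂ) *
        ((q.metric x).map Complex.ofReal * (s.toFun U.1 x).map star *
          (q.metric x).map Complex.ofReal * t.toFun U.2 x).trace /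
        ((U.1 : ℂ) - U.2 - Complex.I * ε) ^ 2) ∂q.area

theorem tendsto_twoPoint_aux (s t : TestTensor q) :
    Tendsto (twoPoint s t) (𝓝[>] 0)
      (𝓝 (∫ p, ∑ i : Fin 3 × Fin 3, star (s.mode p i.1 i.2) * t.mode p i.1 i.2
        ∂(volume : Measure ℝ).prod q.area)) := by
  set G : ℝ × S2 → ℂ := fun p => ∑ i : Fin 3 × Fin 3, star (s.mode p i.1 i.2) * t.mode p i.1 i.2
    with hG
  have hGi : Integrable G ((volume : Measure ℝ).prod q.area) :=
    integrable_finsetSum _ fun i _ => (s.memLp_mode i).star.integrable_mul (t.memLp_mode i)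
  have hcont : ∀ ε : ℝ, Continuous fun p : ℝ × S2 => Complex.exp (-(ε * Real.exp p.1)) :=
    fun ε => by fun_prop
  have hnorm : ∀ ε : ℝ, 0 < ε → ∀ p : ℝ × S2, ‖Complex.exp (-(ε * Real.exp p.1))‖ ≤ 1 := by
    intro ε hε p
    rw [Complex.norm_exp, ← Complex.ofReal_mul, ← Complex.ofReal_neg, Complex.ofReal_re,
      Real.exp_le_one_iff]
    have := Real.exp_pos p.1
    nlinarith
  have hev : ∀ᶠ ε : ℝ in 𝓝[>] 0, ∫ p, Complex.exp (-(ε * Real.exp p.1)) * G p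
        ∂(volume : Measure ℝ).prod q.area = twoPoint s t ε := by
    filter_upwards [self_mem_nhdsWithin] with ε hε
    unfold twoPoint
    simp only [twoPoint_angle s t hε]
    exact integral_prod_symm _ (hGi.bdd_mul (hcont ε).aestronglyMeasurable (.of_forall (hnorm ε hε)))
  refine Tendsto.congr' hev ?_
  refine tendsto_integral_filter_of_dominated_convergence (fun p => ‖G p‖) ?_ ?_ hGi.norm ?_
  · exact .of_forall fun ε => (hcont ε).aestronglyMeasurable.mul hGi.1
  · filter_upwards [self_mem_nhdsWithin] with ε hε
    refine .of_forall fun p => ?_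
    rw [norm_mul]
    exact mul_le_of_le_one_left (norm_nonneg _) (hnorm ε hε p)
  · refine .of_forall fun p => ?_
    have h : Tendsto (fun ε : ℝ => Complex.exp (-(ε * Real.exp p.1)) * G p) (𝓝 0)
        (𝓝 (Complex.exp (-((0 : ℝ) * Real.exp p.1)) * G p)) :=
      Continuous.tendsto (by fun_prop) 0
    simp only [Complex.ofReal_zero, zero_mul, neg_zero, Complex.exp_zero, one_mul] at h
    exact h.mono_left nhdsWithin_le_nhds

theorem inner_symProduct_one (s t : TestTensor q) :
    inner ℂ (TestTensor.symProduct fun _ : Fin 1 => s) (TestTensor.symProduct fun _ : Fin 1 => t)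
      = ∫ p, ∑ i : Fin 3 × Fin 3, star (s.mode p i.1 i.2) * t.mode p i.1 i.2
        ∂(volume : Measure ℝ).prod q.area := by
  rw [L2.inner_def]
  have hp := measurePreserving_funUnique ((volume : Measure ℝ).prod q.area) (Fin 1)
  rw [← hp.integral_comp (MeasurableEquiv.measurableEmbedding _)]
  refine integral_congr_ae ?_
  have h2 := (TestTensor.memLp_symFun fun _ : Fin 1 => s).coeFn_toLp
  have h3 := (TestTensor.memLp_symFun fun _ : Fin 1 => t).coeFn_toLp
  filter_upwards [h2, h3] with p hs ht
  unfold TestTensor.symProduct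
  rw [hs, ht, PiLp.inner_apply, ← (Equiv.funUnique (Fin 1) (Fin 3 × Fin 3)).sum_comp]
  refine Finset.sum_congr rfl fun a _ => ?_
  simp [TestTensor.symFun, mul_comm]

/-- The inner product of one-particle states is the vacuum two-point function. -/
theorem tendsto_twoPoint (s t : TestTensor q) :
    Tendsto (twoPoint s t) (𝓝[>] 0)
      (𝓝 (inner ℂ (TestTensor.symProduct fun _ : Fin 1 => s)
        (TestTensor.symProduct fun _ : Fin 1 => t))) := by
  rw [inner_symProduct_one]
  exact tendsto_twoPoint_aux s t

end TwoPoint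


end Horizon

end

/-! In the log-frequency `L = log k`, the boost supertranslation acts on wavefunctions by
composition with the translation `L ↦ L + κ f(x)`, at fixed angle `x`. A normalizable invariant
state changes only by a phase, so every `‖Ψ_n‖²` is an integrable density invariant under
translating each `L_i` by `κ f(x_i)`. A finite measure cannot be carried off to infinity by a map
that preserves it. By Poincaré recurrence almost every configuration, with respect to this density,
returns infinitely often to a bounded range of `L_i`. Where `f(x_i) ≠ 0`, however, `L_i` drifts
linearly to infinity. Hence `Ψ_n = 0` almost everywhere on `f(x_i) ≠ 0`, for each particle `i`. This
is `IsInvariant.ae_eq_zero`, resting on the abstract `ae_eq_zero_of_norm_comp_eq`. Only norms enter,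
so the phase plays no role.

It remains to dispose of configurations in which a particle sits on a zero of `f`. If the zero set
has area zero, they form a null set. If it merely has empty interior, it may still have positive
area; continuity of `Ψ_n` then extends the vanishing from a dense set to all configurations. If
invariance holds for all `f` in a space `W` of finite codimension, only the common zeros of `W`
matter. There are at most `dim V` of them, `V` being a complement of `W`: smooth functions
interpolate arbitrary values at finitely many points, and at common zeros of `W` these values must
be supplied by `V` alone (`finite_commonZeros`). A finite set has no area.

In each case all sectors with `n ≥ 1` vanish, and the zero-particle sector is spanned by the vacuum.
-/

noncomputable section
namespace Horizon

/-! ### Poincaré recurrence for invariant square-integrable densities. -/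

section Recurrence

variable {α E : Type*} [MeasurableSpace α] [NormedAddCommGroup E] {μ : Measure α} {T : α → α}
  {ψ : α → E}

/-- If the norm of an `L²` function is invariant under a measure preserving map, then the map
preserves the finite measure with density the squared norm. -/
theorem measurePreserving_withDensity_enorm_sq (hT : MeasurePreserving T μ μ)
    (hψ : MemLp ψ 2 μ) (h : ∀ᵐ p ∂μ, ‖ψ (T p)‖ = ‖ψ p‖) :
    MeasurePreserving T (μ.withDensity fun p => ‖ψ p‖ₑ ^ 2) (μ.withDensity fun p => ‖ψ p‖ₑ ^ 2) := by
  have hm : AEMeasurable (fun p => ‖ψ p‖ₑ ^ 2) μ := hψ.1.enorm.pow_const 2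
  refine ⟨hT.measurable, Measure.ext fun s hs => ?_⟩
  rw [Measure.map_apply hT.measurable hs, withDensity_apply _ hs,
    withDensity_apply _ (hT.measurable hs)]
  -- The change of variables runs from `T ⁻¹' s` to `s`, so that the integral over `s` becomes that
  -- of `‖ψ ∘ T‖²` over `T ⁻¹' s`. Invertibility of `T` is not needed.
  have hr : MeasurePreserving T (μ.restrict (T ⁻¹' s)) (μ.restrict s) := hT.restrict_preimage hs
  have hm' : AEMeasurable (fun p => ‖ψ p‖ₑ ^ 2) ((μ.restrict (T ⁻¹' s)).map T) := by
    rw [hr.map_eq]; exact hm.restrict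
  rw [← hr.map_eq, lintegral_map' hm' hT.measurable.aemeasurable]
  refine lintegral_congr_ae (ae_restrict_of_ae ?_)
  filter_upwards [h] with p hp
  rw [← ofReal_norm, ← ofReal_norm, hp]

/-- An `L²` function whose norm is invariant under a measure preserving map vanishes at the points
whose orbits have divergent `u`. -/
theorem ae_eq_zero_of_norm_comp_eq (hT : MeasurePreserving T μ μ) (hψ : MemLp ψ 2 μ)
    (h : ∀ᵐ p ∂μ, ‖ψ (T p)‖ = ‖ψ p‖) {u : α → ℝ} (hu : Measurable u) :
    ∀ᵐ p ∂μ, Tendsto (fun m : ℕ => |u (T^[m] p)|) atTop atTop → ψ p = 0 := by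
  have hm : AEMeasurable (fun p => ‖ψ p‖ₑ ^ 2) μ := hψ.1.enorm.pow_const 2
  have hfin : IsFiniteMeasure (μ.withDensity fun p => ‖ψ p‖ₑ ^ 2) := by
    refine isFiniteMeasure_withDensity ?_
    have := lintegral_rpow_enorm_lt_top_of_eLpNorm_lt_top (by simp) (by simp) hψ.2
    simpa using this.ne
  -- The measure `μ` itself may be infinite and admits drifting maps; finiteness of the weighted
  -- measure is what makes `T` recurrent.
  have hc := (measurePreserving_withDensity_enorm_sq hT hψ h).conservative
  -- Recurrence to the sets `|u| < N`, which exhaust the space. Natural bounds `N` suffice and keep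
  -- the family countable, so one null set serves them all.
  have hrec : ∀ᵐ p ∂(μ.withDensity fun p => ‖ψ p‖ₑ ^ 2), ∀ N : ℕ, |u p| < N →
      ∃ᶠ m : ℕ in atTop, |u (T^[m] p)| < N := by
    rw [ae_all_iff]
    intro N
    exact hc.ae_mem_imp_frequently_image_mem
      (measurableSet_lt (measurable_abs.comp hu) measurable_const).nullMeasurableSet
  -- Almost everywhere for the weighted measure means `μ`-almost everywhere among the points with `ψ
  -- p ≠ 0`.
  rw [ae_withDensity_iff' hm] at hrec
  filter_upwards [hrec] with p hp hlim
  by_contra hne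
  obtain ⟨N, hN⟩ := exists_nat_gt |u p|
  obtain ⟨m, h1, h2⟩ := ((hp (by simpa using hne) N hN).and_eventually
    (hlim.eventually_ge_atTop (N : ℝ))).exists
  exact absurd h1 (not_lt.2 h2)

end Recurrence

/-! ### Null sets and open sets for the area and configuration measures. -/

section Area

/-- The measure of a subset of the sphere is, up to a factor, the volume of the cone over it. The
cone over a point lies in a line, a proper subspace of `ℝ³`, hence is null. -/
theorem toSphere_singleton (x : S2) : (volume : Measure E3).toSphere {x} = 0 := by
  rw [Measure.toSphere_apply' _ (measurableSet_singleton x)]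
  have hne : Submodule.span ℝ {(x : E3)} ≠ ⊤ := fun h => by
    have h1 : Module.finrank ℝ (Submodule.span ℝ {(x : E3)}) ≤ 1 :=
      (finrank_span_le_card _).trans (by simp)
    rw [h, finrank_top, finrank_euclideanSpace_fin] at h1
    omega
  rw [measure_mono_null _ (Measure.addHaar_submodule volume _ hne), mul_zero]
  rintro _ ⟨r, -, y, hy, rfl⟩
  simp only [Set.image_singleton, Set.mem_singleton_iff] at hy
  subst hy
  exact Submodule.smul_mem _ _ (Submodule.mem_span_singleton_self _)

instance (q : HorizonMetric) : NullSingletonClass q.area :=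
  ⟨fun x => withDensity_absolutelyContinuous _ _ (toSphere_singleton x)⟩

/-- The density `√det q` is strictly positive, so the round measure is absolutely continuous with
respect to the area. On configurations this allows an almost everywhere equality of continuous
functions to be upgraded to equality everywhere. -/
instance (q : HorizonMetric) : q.area.IsOpenPosMeasure := by
  refine (?_ : (volume : Measure E3).toSphere ≪ q.area).isOpenPosMeasure
  refine withDensity_absolutelyContinuous' q.continuous_areaDensity.measurable.ennreal_ofReal.aemeasurable
    (.of_forall fun x => ?_)
  simpa using (q.posDef x).det_pos

instance (q : HorizonMetric) (n : ℕ) : (confMeasure q n).IsOpenPosMeasure := by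
  have : ((volume : Measure ℝ).prod q.area).IsOpenPosMeasure :=
    Measure.prod.instIsOpenPosMeasure
  exact Measure.pi.isOpenPosMeasure (fun _ : Fin n => (volume : Measure ℝ).prod q.area)

theorem ae_angle_notMem {q : HorizonMetric} {s : Set S2} (hs : q.area s = 0) (n : ℕ) (i : Fin n) :
    ∀ᵐ p ∂confMeasure q n, (p i).2 ∉ s :=
  (Measure.quasiMeasurePreserving_snd.comp
    (Measure.quasiMeasurePreserving_eval _ i)).ae (measure_eq_zero_iff_ae_notMem.1 hs)

end Area

/-! ### Common zeros of spaces of smooth functions of finite codimension. -/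

section FiniteCodimension

/-- Smooth functions on the sphere interpolate arbitrary values on a finite set. -/
theorem Supertranslation.exists_interpolation (t : Finset S2) (a : t → ℝ) :
    ∃ f : Supertranslation, ∀ x : t, f x = a x := by
  classical
  -- Smooth Urysohn functions separating one point of `t` from the others give a dual basis for
  -- evaluation on `t`.
  have h : ∀ x : t, ∃ f : Supertranslation, ∀ y : t, f y = if y = x then 1 else 0 := by
    intro x
    obtain ⟨f, h0, h1, -⟩ := exists_contMDiffMap_zero_one_of_isClosed (n := ⊤) (𝓡 2)
      (s := (↑(t.erase x) : Set S2)) (t := {(x : S2)}) (Finset.finite_toSet _).isClosed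
      isClosed_singleton (by simp)
    refine ⟨f, fun y => ?_⟩
    split_ifs with hy
    · subst hy; exact h1 rfl
    · exact h0 (Finset.mem_coe.2 (Finset.mem_erase.2 ⟨fun e => hy (Subtype.ext e), y.2⟩))
  choose f hf using h
  have hev : ∀ y : S2, (∑ x, a x • f x) y = ∑ x, a x * f x y := fun y => by
    have := map_sum ((Pi.evalRingHom (fun _ : S2 => ℝ) y).toAddMonoidHom.comp
      (ContMDiffMap.coeFnAddMonoidHom (I := 𝓡 2) (N := S2) (n := ∞) (G := ℝ) (I' := 𝓘(ℝ, ℝ))))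
      (fun x => a x • f x) Finset.univ
    exact this
  refine ⟨∑ x, a x • f x, fun y => ?_⟩
  rw [hev]
  simp [hf]

/-- The common zeros of a space of smooth functions of finite codimension are finitely many. -/
theorem finite_commonZeros {V W : Submodule ℝ Supertranslation} [FiniteDimensional ℝ V]
    (h : IsCompl V W) : {x : S2 | ∀ f ∈ W, f x = 0}.Finite := by
  by_contra hinf
  -- One point more than `dim V` makes a surjection of `V` onto the functions on `t` impossible.
  obtain ⟨t, ht, hcard⟩ := Set.Infinite.exists_subset_card_eq hinf (Module.finrank ℝ V + 1)
  let ev : V →ₗ[ℝ] (t → ℝ) :=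
    { toFun := fun f x => (f : Supertranslation) x
      map_add' := fun _ _ => rfl
      map_smul' := fun _ _ => rfl }
  have hsurj : Function.Surjective ev := by
    intro a
    obtain ⟨f, hf⟩ := Supertranslation.exists_interpolation t a
    -- Split the interpolating function as `v + w`; since `w` vanishes on `t`, `v` alone takes the
    -- prescribed values.
    obtain ⟨v, hv, w, hw, rfl⟩ := Submodule.mem_sup.1 (h.sup_eq_top ▸ Submodule.mem_top : f ∈ V ⊔ W)
    refine ⟨⟨v, hv⟩, funext fun x => ?_⟩
    rw [← hf x]
    show v x = v x + w x
    rw [ht x.2 w hw, add_zero]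
  have := LinearMap.finrank_le_finrank_of_surjective hsurj
  rw [Module.finrank_fintype_fun_eq_card, Fintype.card_coe, hcard] at this
  omega

/-- The sphere is second countable, so by the Lindelöf property countably many of the open sets `f ≠
0` have the same union as all of them. Each `f` brings its own exceptional null set, and only
countably many of these can be discarded at once. -/
theorem exists_countable_commonZeros (W : Set Supertranslation) :
    ∃ C ⊆ W, C.Countable ∧ ∀ x : S2, (∀ f ∈ C, f x = 0) → ∀ f ∈ W, f x = 0 := by
  obtain ⟨T, hT, hU⟩ := TopologicalSpace.isOpen_iUnion_countable
    (fun f : W => {x : S2 | (f : Supertranslation) x ≠ 0})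
    fun f => (f : Supertranslation).contMDiff.continuous.isOpen_preimage _ isOpen_ne
  refine ⟨(↑) '' T, by simp, hT.image _, fun x hx f hf => ?_⟩
  by_contra hne
  have : x ∈ ⋃ f : W, {x : S2 | (f : Supertranslation) x ≠ 0} := Set.mem_iUnion.2 ⟨⟨f, hf⟩, hne⟩
  rw [← hU] at this
  simp only [Set.mem_iUnion] at this
  obtain ⟨g, hg, hgx⟩ := this
  exact hgx (hx g ⟨g, hg, rfl⟩)

end FiniteCodimension

/-! ### Invariant states and the vacuum. -/

section States

variable {q : HorizonMetric} {κ : ℝ} {f : Supertranslation} {Ψ : Fock q}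

/-- The vacuum is the product of an empty family of test tensors; a symmetry acts on each factor,
and there is none to act on. -/
theorem act_vacuum (g : Symmetry q) (κ : ℝ) : g.act κ (vacuum q) = vacuum q := by
  refine lp.ext (funext fun n => ?_)
  rw [g.act_apply]
  rcases eq_or_ne n 0 with rfl | hn
  · simp only [vacuum, lp.single_apply_self]
    refine Subtype.ext ((g.ambientAct_symProduct κ _).trans ?_)
    congr 1
    exact Subsingleton.elim _ _
  · simp only [vacuum, lp.single_apply_ne _ _ _ hn, map_zero]

/-- The angle never moves, so the step `κ f(x)` is the same at every iteration and the drift is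
linear in `m`. -/
theorem iterate_boost_flow (f : Supertranslation) (κ : ℝ) {n : ℕ} (p : Conf n) (m : ℕ) (i : Fin n) :
    (fun (p : Conf n) i => (Symmetry.boost q f).flow κ (p i))^[m] p i
      = ((p i).1 + m * (κ * f (p i).2), (p i).2) := by
  induction m with
  | zero => simp
  | succ m ih =>
    rw [Function.iterate_succ_apply', ih]
    refine Prod.ext ?_ rfl
    show _ + κ * f _ = _
    push_cast
    ring

/-- Invariance of a non-zero state is up to a phase, so the norm of its wavefunctions is
invariant. -/
theorem IsInvariant.norm_flow (hΨ : Ψ ≠ 0) (h : IsInvariant κ f Ψ) (n : ℕ) :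
    ∀ᵐ p ∂confMeasure q n,
      ‖((Ψ : ∀ n, NParticle q n) n : Lp (Pol n) 2 (confMeasure q n))
        fun i => (Symmetry.boost q f).flow κ (p i)‖
      = ‖((Ψ : ∀ n, NParticle q n) n : Lp (Pol n) 2 (confMeasure q n)) p‖ := by
  obtain ⟨c, hc⟩ := h
  -- The symmetry acts isometrically and `Ψ ≠ 0`, so the multiple is a phase.
  have hc1 : ‖c‖ = 1 := by
    have := congrArg norm hc
    rw [LinearIsometry.norm_map, norm_smul] at this
    exact (mul_eq_right₀ (norm_ne_zero_iff.2 hΨ)).1 this.symm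
  have hψ : (Symmetry.boost q f).ambientAct κ n ((Ψ : ∀ n, NParticle q n) n)
      = c • ((Ψ : ∀ n, NParticle q n) n : Lp (Pol n) 2 (confMeasure q n)) :=
    congrArg (fun Φ : Fock q => (((Φ : ∀ n, NParticle q n) n : NParticle q n) :
      Lp (Pol n) 2 (confMeasure q n))) hc
  generalize ((Ψ : ∀ n, NParticle q n) n : Lp (Pol n) 2 (confMeasure q n)) = ψ at hψ ⊢
  have h1 := (Symmetry.boost q f).ambientAct_ae κ n ψ
  rw [hψ] at h1
  filter_upwards [h1, Lp.coeFn_smul c ψ] with p hp hp'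
  rw [← ((Symmetry.boost q f).polIsometry n).norm_map, ← hp, hp', Pi.smul_apply, norm_smul, hc1,
    one_mul]

/-- The `n`-particle wavefunction of an invariant state vanishes wherever the supertranslation
moves one of the particles. -/
theorem IsInvariant.ae_eq_zero (hκ : κ ≠ 0) (hΨ : Ψ ≠ 0) (h : IsInvariant κ f Ψ)
    (n : ℕ) (i : Fin n) : ∀ᵐ p ∂confMeasure q n, f (p i).2 ≠ 0 →
      ((Ψ : ∀ n, NParticle q n) n : Lp (Pol n) 2 (confMeasure q n)) p = 0 := by
  have hnorm := h.norm_flow hΨ n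
  generalize ((Ψ : ∀ n, NParticle q n) n : Lp (Pol n) 2 (confMeasure q n)) = ψ at hnorm ⊢
  -- The log-frequency of particle `i` is the escaping coordinate; what the other particles do is
  -- irrelevant.
  filter_upwards [ae_eq_zero_of_norm_comp_eq
    ((Symmetry.boost q f).measurePreserving_flow_pi κ n) (Lp.memLp ψ) hnorm
    (u := fun p => (p i).1) (by fun_prop)] with p hp hne
  refine hp ?_
  simp only [iterate_boost_flow]
  have hv : κ * f (p i).2 ≠ 0 := mul_ne_zero hκ hne
  -- The reverse triangle inequality bounds `|L_i + m κ f|` below by this, whatever the sign of `f`.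
  have hlin : Tendsto (fun m : ℕ => (m : ℝ) * |κ * f (p i).2| - |(p i).1|) atTop atTop :=
    tendsto_atTop_add_const_right _ _
      (tendsto_natCast_atTop_atTop.atTop_mul_const (abs_pos.2 hv))
  refine tendsto_atTop_mono (fun m => ?_) hlin
  have h1 := abs_sub_abs_le_abs_add ((m : ℝ) * (κ * f (p i).2)) (p i).1
  rw [abs_mul, Nat.abs_cast, add_comm] at h1
  exact h1

/-- A state without particles is the vacuum. -/
theorem isVacuumState_of_forall_ne_zero (hΨ : ‖Ψ‖ = 1)
    (h : ∀ n ≠ 0, (Ψ : ∀ n, NParticle q n) n = 0) : IsVacuumState Ψ := by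
  set ψ : Lp (Pol 0) 2 (confMeasure q 0) := Subtype.val ((Ψ : ∀ n, NParticle q n) 0)
  have key : ∃ z : ℂ, Ψ = z • vacuum q := by
    -- With no particles there is one configuration and one polarisation index, so the wavefunction
    -- is a single number; that of the vacuum is `1`.
    refine ⟨ψ default default, lp.ext (funext fun n => ?_)⟩
    rw [lp.coeFn_smul, Pi.smul_apply]
    rcases eq_or_ne n 0 with rfl | hn
    · simp only [vacuum, lp.single_apply_self]
      refine Subtype.ext (Lp.ext ?_)
      refine EventuallyEq.trans ?_ (Lp.coeFn_smul _ _).symm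
      filter_upwards [(TestTensor.memLp_symFun (q := q) Fin.elim0).coeFn_toLp] with p hp
      rw [Pi.smul_apply]
      unfold TestTensor.symProduct
      rw [hp]
      ext a
      obtain rfl : p = default := Subsingleton.elim _ _
      obtain rfl : a = default := Subsingleton.elim _ _
      simp [TestTensor.symFun, ψ]
    · simp only [h n hn, vacuum, lp.single_apply_ne _ _ _ hn, smul_zero]
  obtain ⟨z, rfl⟩ := key
  rw [norm_smul, norm_vacuum, mul_one] at hΨ
  exact ⟨z, hΨ, rfl⟩

/-- The argument in `Fin n` both encodes `n ≥ 1` and supplies the particle whose motion forces the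
vanishing. -/
theorem isVacuumState_of_ae_eq_zero (hΨ : ‖Ψ‖ = 1)
    (h : ∀ n, ∀ _ : Fin n, ∀ᵐ p ∂confMeasure q n,
      ((Ψ : ∀ n, NParticle q n) n : Lp (Pol n) 2 (confMeasure q n)) p = 0) : IsVacuumState Ψ :=
  isVacuumState_of_forall_ne_zero hΨ fun n hn =>
    Subtype.ext ((Lp.eq_zero_iff_ae_eq_zero).2 (h n ⟨0, Nat.pos_of_ne_zero hn⟩))

theorem IsInvariant.isVacuumState_of_area_zeros (hκ : κ ≠ 0) (hΨ : ‖Ψ‖ = 1) (h : IsInvariant κ f Ψ)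
    (hf : q.area {x | f x = 0} = 0) : IsVacuumState Ψ := by
  have h0 : Ψ ≠ 0 := fun h0 => by simp [h0] at hΨ
  refine isVacuumState_of_ae_eq_zero hΨ fun n i => ?_
  filter_upwards [h.ae_eq_zero hκ h0 n i, ae_angle_notMem hf n i] with p hp hp'
  exact hp hp'

/-- Invariance gives nothing on the zeros of `f`, which may have positive area. The product of `f`
with the wavefunction vanishes almost everywhere without exception, and it is continuous, so it
vanishes identically; dividing by `f` on a dense set and using continuity again finishes. -/
theorem IsInvariant.isVacuumState_of_continuous (hκ : κ ≠ 0) (hΨ : ‖Ψ‖ = 1) (h : IsInvariant κ f Ψ)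
    (hf : Dense {x | f x ≠ 0}) (hc : HasContinuousWavefunctions Ψ) : IsVacuumState Ψ := by
  have h0 : Ψ ≠ 0 := fun h0 => by simp [h0] at hΨ
  refine isVacuumState_of_ae_eq_zero hΨ fun n i => ?_
  obtain ⟨φ, hφ, hψφ⟩ := hc n
  have hfc : Continuous fun p : Conf n => f (p i).2 :=
    f.contMDiff.continuous.comp (by fun_prop)
  -- Preimages of dense sets under open maps are dense, and reading off the angle of one particle is
  -- open.
  have hdense : Dense {p : Conf n | f (p i).2 ≠ 0} :=
    hf.preimage (isOpenMap_snd.comp (isOpenMap_eval i))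
  have hprod : (fun p : Conf n => f (p i).2 • φ p) = fun _ => 0 := by
    refine Continuous.ae_eq_iff_eq (confMeasure q n) (hfc.smul hφ) continuous_const |>.1 ?_
    filter_upwards [h.ae_eq_zero hκ h0 n i, hψφ] with p hp hp'
    simp only [Pi.smul_apply']
    by_cases hz : f (p i).2 = 0
    · rw [hz, zero_smul]
    · rw [← hp', hp hz, smul_zero]
  have hφ0 : φ = fun _ => 0 := hφ.ext_on hdense continuous_const fun p hp =>
    (smul_eq_zero.1 (congrFun hprod p)).resolve_left hp
  filter_upwards [hψφ] with p hp
  rw [hp, hφ0]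

/-- Almost every configuration has particle `i` away from the finitely many common zeros of `W`, so
some `f` in the countable family moves it and the wavefunction vanishes there. -/
theorem isVacuumState_of_forall_mem {V W : Submodule ℝ Supertranslation} [FiniteDimensional ℝ V]
    (hVW : IsCompl V W) (hκ : κ ≠ 0) (hΨ : ‖Ψ‖ = 1) (h : ∀ f ∈ W, IsInvariant κ f Ψ) :
    IsVacuumState Ψ := by
  have h0 : Ψ ≠ 0 := fun h0 => by simp [h0] at hΨ
  obtain ⟨C, hCW, hC, hzero⟩ := exists_countable_commonZeros (W : Set Supertranslation)
  refine isVacuumState_of_ae_eq_zero hΨ fun n i => ?_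
  filter_upwards [(ae_ball_iff hC).2 fun f hf => (h f (hCW hf)).ae_eq_zero hκ h0 n i,
    ae_angle_notMem (q := q) ((finite_commonZeros hVW).measure_zero _) n i] with p hp hp'
  by_contra hne
  exact hp' (hzero _ fun f hf => by_contra fun hfx => hne (hp f hf hfx))

end States

end Horizon

end

/-! ### The main theorem. -/

open Horizon in
theorem theorem1 (q : HorizonMetric) (κ : ℝ) (hκ : 0 < κ) :
    (∀ f : Supertranslation, (∀ O : Set S2, IsOpen O → O.Nonempty → ∃ x ∈ O, f x ≠ 0) →
      ∀ Ψ : Fock q, ‖Ψ‖ = 1 → IsInvariant κ f Ψ →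
        (q.area {x | f x = 0} = 0 ∨ HasContinuousWavefunctions Ψ) → IsVacuumState Ψ) ∧
    (∀ g : Symmetry q, g.act κ (vacuum q) = vacuum q) ∧
    (∀ K : Set (Symmetry q), FiniteDimensional ℝ (boostPart K) →
      ¬ AdmitsNontrivialRestriction κ K) := by
  refine ⟨fun f hf Ψ hΨ h hor => ?_, fun g => act_vacuum g κ, ?_⟩
  · rcases hor with hz | hc
    · exact h.isVacuumState_of_area_zeros hκ.ne' hΨ hz
    · exact h.isVacuumState_of_continuous hκ.ne' hΨ (dense_iff_inter_open.2 hf) hc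
  · rintro K hK ⟨W, hW, Ψ, hΨ, hinv, hvac⟩
    exact hvac (isVacuumState_of_forall_mem hW hκ.ne' hΨ hinv)
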